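/- **Setting.** Let $\mathcal I=\{u:\mathbb Z\to[0,1]\}$, and let $\omega:\mathbb Z_{\le 0}\to(0,1]$ be increasing with $\omega_0=1$ and $\omega_t\to0$ as $t\to-\infty$; put $d_\omega(u,v)=\sup_{t\le 0}|u_t-v_t|\,\omega_t$. A *fading-memory filter* is a causal, time-invariant map $F:\mathcal I\to\mathbb R^{\mathbb Z}$ whose functional $u\mapsto F(u)_0$ is continuous for $d_\omega$. A *gate-based quantum echo state network* consists of: a register of $N$ qubits; an encoding circuit $U(x)$, a finite product of CNOT gates and of rotations $RX,RY,RZ$ of single qubits with angles $\alpha x+\beta$ ($\alpha,\beta\in\mathbb R$ fixed for each gate); a quantum channel $\mathcal E$ on the $N$ qubits (the noise); a set $M$ of measured qubits; and real weights $(w_s)_{s\in M}$. On input value $x$ its state evolves by $$\Phi_x(\rho)=\sum_{m\in\{0,1\}^M}\Pi_m\,\mathcal E\big(U(x)\rho U(x)^\dagger\big)\,\Pi_m^\dagger ,$$ where $\Pi_m$ is the projector onto the outcome $m$ of the measurement of the qubits in $M$ in the computational basis (mid-circuit measurement, averaged over the outcomes). It has the *echo state property* if for each $u\in\mathcal I$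 there is exactly one sequence $(\rho_t)_{t\in\mathbb Z}$ of density operators with $\rho_{t+1}=\Phi_{u_{t+1}}(\rho_t)$ for all $t$; its filter is then $\mathcal C(u)_t=\sum_{s\in M}w_s\,\mathrm{tr}(Z_s\rho_t)$. *Spatial multiplexing* runs two networks in parallel on the same input and adds, or multiplies, their outputs; it may be iterated. For a class $\mathcal N$ of channels (on registers of any number of qubits), $\mathcal R(\mathcal N)$ is the family of all multiplexed networks whose components have noise in $\mathcal N$. It is *universal* if for every fading-memory filter $F$ and every $\varepsilon>0$ some network in $\mathcal R(\mathcal N)$ has the echo state property and a filter $\mathcal C$ with $|\mathcal C(u)_t-F(u)_t|<\varepsilon$ for all $u\in\mathcal I$, $t\in\mathbb Z$. A channel is *strictly contractive* if for some $r<1$, $\|\mathcal E(\rho)-\mathcal E(\sigma)\|_1\le r\|\rho-\sigma\|_1$ for all density operators $\rho,\sigma$, with $\|A\|_1=\mathrm{tr}\sqrt{A^\dagger A}$, and *non-unital* if $\mathcal E(\mathbb I)\ne\mathbb I$. A one-qubit channel *has input-dependent fixed points* if there is a one-qubit encoding circuit such that, with the qubit being measured, for each $x\in[0,1]$ the map $\Phi_x$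 has a unique fixed point $\rho_*^x$ among the density operators, and $x\mapsto\rho_*^x$ is injective. **Theorem.** For every such $\omega$: 1. Every multiplexed network whose components have strictly contractive noise has the echo state property (in each component), and its filter is a fading-memory filter. 2. If $\mathcal N$ is a class of non-unital, strictly contractive channels that contains a one-qubit channel with input-dependent fixed points, then $\mathcal R(\mathcal N)$ is universal. 3. For every $\gamma\in(0,1)$, the class $\mathcal N$ consisting, for each $N\ge1$, of the amplitude damping channel of strength $\gamma$ applied to each of $N$ qubits satisfies the hypotheses of 2, so $\mathcal R(\mathcal N)$ is universal. (The one-qubit channel has Kraus operators $K_0=\begin{pmatrix}1&0\\0&\sqrt{1-\gamma}\end{pmatrix}$, $K_1=\begin{pmatrix}0&\sqrt\gamma\\0&0\end{pmatrix}$.) 4. The family of all multiplexed networks with non-unital, strictly contractive noise is universal. -/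

import Mathlib

namespace QESN

noncomputable section

open scoped MatrixOrder ComplexOrder

/-! ### Inputs, weights and fading-memory filters -/

/-- Input sequences `u : ℤ → [0,1]`. -/
abbrev Input : Type := ℤ → Set.Icc (0 : ℝ) 1

/-- A weight on the non-positive integers: increasing, with values in `(0,1]`, equal to `1` at time
`0` and vanishing at `-∞`. The values of `ω` at positive times are never used. -/
structure IsFadingWeight (ω : ℤ → ℝ) : Prop where
  pos : ∀ t, t ≤ 0 → 0 < ω t
  le_one : ∀ t, t ≤ 0 → ω t ≤ 1
  mono : ∀ s t, s ≤ t → t ≤ 0 → ω s ≤ ω t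
  at_zero : ω 0 = 1
  tendsto_zero : Filter.Tendsto ω Filter.atBot (nhds 0)

/-- The weighted distance `d_ω(u,v) = sup_{t ≤ 0} |u_t - v_t| ω_t` between the pasts of two input
sequences. -/
def fadingDist (ω : ℤ → ℝ) (u v : Input) : ℝ :=
  ⨆ t : Set.Iic (0 : ℤ), |(u t : ℝ) - (v t : ℝ)| * ω t

/-- A functional of input sequences has fading memory if it is continuous for `d_ω`. -/
def HasFadingMemory (ω : ℤ → ℝ) (H : Input → ℝ) : Prop :=
  ∀ u : Input, ∀ ε > 0, ∃ δ > 0, ∀ v : Input, fadingDist ω u v < δ → |H v - H u| < ε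

/-- The sequence `u` advanced by `τ` time steps. -/
def shift (τ : ℤ) (u : Input) : Input := fun t => u (t + τ)

/-- A fading-memory filter: a causal and time-invariant operator from input sequences to real
sequences whose associated functional `u ↦ F(u)_0` has fading memory. -/
structure IsFadingMemoryFilter (ω : ℤ → ℝ) (F : Input → ℤ → ℝ) : Prop where
  causal : ∀ (u v : Input) (t : ℤ), (∀ s, s ≤ t → u s = v s) → F u t = F v t
  time_invariant : ∀ (τ : ℤ) (u : Input) (t : ℤ), F (shift τ u) t = F u (t + τ)
  fading : HasFadingMemory ω (fun u => F u 0)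

/-! ### Quantum states and channels on a register of `N` qubits -/

/-- Operators on the Hilbert space of `N` qubits, as matrices in the computational basis, which is
indexed by bit strings. -/
abbrev Op (N : ℕ) : Type := Matrix (Fin N → Fin 2) (Fin N → Fin 2) ℂ

/-- Density operators. -/
def IsDensity {N : ℕ} (ρ : Op N) : Prop := ρ.PosSemidef ∧ ρ.trace = 1

/-- The trace norm `tr √(A† A)`. -/
def traceNorm {N : ℕ} (A : Op N) : ℝ := (CFC.sqrt (A.conjTranspose * A)).trace.re

/-- The linear map `ρ ↦ ∑ₐ Kₐ ρ Kₐ†`. -/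
def krausMap {N : ℕ} {ι : Type} [Fintype ι] (K : ι → Op N) : Op N →ₗ[ℂ] Op N :=
  ∑ a, (LinearMap.mulRight ℂ (K a).conjTranspose) ∘ₗ (LinearMap.mulLeft ℂ (K a))

/-- Quantum channels, i.e. completely positive trace-preserving maps, in Kraus form. -/
def IsQuantumChannel {N : ℕ} (E : Op N →ₗ[ℂ] Op N) : Prop :=
  ∃ (r : ℕ) (K : Fin r → Op N), ∑ a, (K a).conjTranspose * K a = 1 ∧ E = krausMap K

/-- Strict contractivity on density operators in the trace norm. -/
def IsStrictlyContractive {N : ℕ} (E : Op N →ₗ[ℂ] Op N) : Prop :=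
  ∃ r : ℝ, r < 1 ∧ ∀ ρ σ : Op N, IsDensity ρ → IsDensity σ →
    traceNorm (E ρ - E σ) ≤ r * traceNorm (ρ - σ)

/-- Unital maps. -/
def IsUnital {N : ℕ} (E : Op N →ₗ[ℂ] Op N) : Prop := E 1 = 1

/-- The two Kraus operators of the one-qubit amplitude damping channel. -/
def adKraus (γ : ℝ) : Fin 2 → Matrix (Fin 2) (Fin 2) ℂ :=
  ![!![1, 0; 0, (Real.sqrt (1 - γ) : ℂ)], !![0, (Real.sqrt γ : ℂ); 0, 0]]

/-- Amplitude damping of strength `γ` acting on each of `N` qubits. Its Kraus operators are the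
tensor products of the one-qubit ones. -/
def amplitudeDamping (γ : ℝ) (N : ℕ) : Op N →ₗ[ℂ] Op N :=
  krausMap fun a : Fin N → Fin 2 => Matrix.of fun i j => ∏ s, adKraus γ (a s) (i s) (j s)

/-! ### Input-encoding circuits -/

/-- The rotation `RX(θ) = exp(-i θ X / 2)`. -/
def rotX (θ : ℝ) : Matrix (Fin 2) (Fin 2) ℂ :=
  !![(Real.cos (θ / 2) : ℂ), -Complex.I * (Real.sin (θ / 2) : ℂ);
     -Complex.I * (Real.sin (θ / 2) : ℂ), (Real.cos (θ / 2) : ℂ)]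

/-- The rotation `RY(θ) = exp(-i θ Y / 2)`. -/
def rotY (θ : ℝ) : Matrix (Fin 2) (Fin 2) ℂ :=
  !![(Real.cos (θ / 2) : ℂ), -(Real.sin (θ / 2) : ℂ);
     (Real.sin (θ / 2) : ℂ), (Real.cos (θ / 2) : ℂ)]

/-- The rotation `RZ(θ) = exp(-i θ Z / 2)`. -/
def rotZ (θ : ℝ) : Matrix (Fin 2) (Fin 2) ℂ :=
  !![Complex.exp (-Complex.I * ((θ / 2 : ℝ) : ℂ)), 0;
     0, Complex.exp (Complex.I * ((θ / 2 : ℝ) : ℂ))]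

/-- A one-qubit operator acting on qubit `s` of the register. -/
def onQubit {N : ℕ} (s : Fin N) (A : Matrix (Fin 2) (Fin 2) ℂ) : Op N :=
  Matrix.of fun i j => if ∀ k, k ≠ s → i k = j k then A (i s) (j s) else 0

/-- The CNOT gate with control qubit `c` and target qubit `t`. -/
def cnotMatrix {N : ℕ} (c t : Fin N) : Op N :=
  Matrix.of fun i j => if i = Function.update j t (j t + j c) then 1 else 0

/-- Gates of a circuit. The rotation angle for the input value `x` is `α x + β`; a gate with
`α = 0` is a fixed rotation. -/
inductive Gate (N : ℕ) : Type
  | rx (s : Fin N) (α β : ℝ) : Gate N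
  | ry (s : Fin N) (α β : ℝ) : Gate N
  | rz (s : Fin N) (α β : ℝ) : Gate N
  | cnot (c t : Fin N) (h : c ≠ t) : Gate N

/-- The unitary matrix of a gate when the input value is `x`. -/
def Gate.matrix {N : ℕ} (x : ℝ) : Gate N → Op N
  | .rx s α β => onQubit s (rotX (α * x + β))
  | .ry s α β => onQubit s (rotY (α * x + β))
  | .rz s α β => onQubit s (rotZ (α * x + β))
  | .cnot c t _ => cnotMatrix c t

/-- A circuit is a list of gates, the head of the list being applied first. -/
abbrev Circuit (N : ℕ) : Type := List (Gate N)

/-- The encoding unitary `U(x)` of a circuit. -/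
def circuitUnitary {N : ℕ} (x : ℝ) : Circuit N → Op N
  | [] => 1
  | g :: gs => circuitUnitary x gs * g.matrix x

/-! ### Mid-circuit measurements -/

/-- The projector onto the outcome `m` of the measurement, in the computational basis, of the
qubits in `M`. -/
def outcomeProj {N : ℕ} (M : Finset (Fin N)) (m : M → Fin 2) : Op N :=
  Matrix.diagonal fun i => if ∀ s : M, i s = m s then 1 else 0

/-- The state after the measurement of the qubits in `M`: the statistical mixture
`∑ₘ Πₘ ρ Πₘ†` of the collapsed states over all outcomes. -/
def midMeasure {N : ℕ} (M : Finset (Fin N)) (ρ : Op N) : Op N :=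
  ∑ m : M → Fin 2, outcomeProj M m * ρ * (outcomeProj M m).conjTranspose

/-- The observable `Z` of qubit `s`. -/
def pauliZ {N : ℕ} (s : Fin N) : Op N :=
  Matrix.diagonal fun i => if i s = 0 then 1 else -1

/-- One time step on input value `x`: encoding unitary, noise, mid-circuit measurement. -/
def step {N : ℕ} (C : Circuit N) (E : Op N →ₗ[ℂ] Op N) (M : Finset (Fin N)) (x : ℝ)
    (ρ : Op N) : Op N :=
  midMeasure M (E (circuitUnitary x C * ρ * (circuitUnitary x C).conjTranspose))

/-! ### Echo state networks -/

/-- A gate-based quantum echo state network: register size, encoding circuit, noise, measured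
qubits, and the weights of the linear readout. -/
structure Network where
  qubits : ℕ
  circuit : Circuit qubits
  noise : Op qubits →ₗ[ℂ] Op qubits
  measured : Finset (Fin qubits)
  weight : Fin qubits → ℝ

namespace Network

/-- The linear readout `∑_{s measured} w_s ⟨Z_s⟩_ρ`. -/
def readout (R : Network) (ρ : Op R.qubits) : ℝ :=
  ∑ s ∈ R.measured, R.weight s * (pauliZ s * ρ).trace.re

/-- State sequences of the network, on all times, that are driven by the input `u`. -/
def IsTrajectory (R : Network) (u : Input) (ρ : ℤ → Op R.qubits) : Prop :=
  (∀ t, IsDensity (ρ t)) ∧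
    ∀ t, ρ (t + 1) = step R.circuit R.noise R.measured (u (t + 1)) (ρ t)

/-- The echo state property: every input drives exactly one state sequence. -/
def EchoState (R : Network) : Prop := ∀ u : Input, ∃! ρ, R.IsTrajectory u ρ

open Classical in
/-- The filter of a network: the readout along the state sequence driven by the input (and `0` if
there is none). -/
def filter (R : Network) (u : Input) (t : ℤ) : ℝ :=
  if h : ∃ ρ, R.IsTrajectory u ρ then R.readout (h.choose t) else 0

end Network

/-- Spatially multiplexed networks: two networks are run in parallel on the same input, and their
outputs are added or multiplied. -/
inductive Multiplexed : Type
  | single (R : Network) : Multiplexed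
  | sum (A B : Multiplexed) : Multiplexed
  | prod (A B : Multiplexed) : Multiplexed

namespace Multiplexed

/-- The filter of a multiplexed network. -/
def filter : Multiplexed → Input → ℤ → ℝ
  | single R => R.filter
  | sum A B => fun u t => A.filter u t + B.filter u t
  | prod A B => fun u t => A.filter u t * B.filter u t

/-- Every component has the echo state property. -/
def EchoState : Multiplexed → Prop
  | single R => R.EchoState
  | sum A B => A.EchoState ∧ B.EchoState
  | prod A B => A.EchoState ∧ B.EchoState

/-- Every component is subject to noise from the class `𝒩`, where `𝒩 N` is the set of admissible
noise maps on `N` qubits. -/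
def UsesNoise (𝒩 : ∀ N : ℕ, Set (Op N →ₗ[ℂ] Op N)) : Multiplexed → Prop
  | single R => R.noise ∈ 𝒩 R.qubits
  | sum A B => A.UsesNoise 𝒩 ∧ B.UsesNoise 𝒩
  | prod A B => A.UsesNoise 𝒩 ∧ B.UsesNoise 𝒩

end Multiplexed

/-- The multiplexed networks with noise from `𝒩` are universal: every fading-memory filter is
approximated to arbitrary precision, uniformly in the input and in time. -/
def IsUniversal (ω : ℤ → ℝ) (𝒩 : ∀ N : ℕ, Set (Op N →ₗ[ℂ] Op N)) : Prop :=
  ∀ F : Input → ℤ → ℝ, IsFadingMemoryFilter ω F → ∀ ε > 0,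
    ∃ A : Multiplexed, A.UsesNoise 𝒩 ∧ A.EchoState ∧ ∀ u t, |A.filter u t - F u t| < ε

/-! ### Noise models -/

/-- A one-qubit noise has input-dependent fixed points if, for some encoding circuit, the one-step
evolution of the measured qubit on each input value `x` has a unique fixed point among the density
operators, and different input values have different fixed points. -/
def HasInputDependentFixedPoint (E : Op 1 →ₗ[ℂ] Op 1) : Prop :=
  ∃ (C : Circuit 1) (ρ : Set.Icc (0 : ℝ) 1 → Op 1), Function.Injective ρ ∧
    ∀ x, IsDensity (ρ x) ∧ ∀ σ, IsDensity σ → (step C E Finset.univ x σ = σ ↔ σ = ρ x)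

/-- All strictly contractive quantum channels. -/
def contractiveNoise (N : ℕ) : Set (Op N →ₗ[ℂ] Op N) :=
  {E | IsQuantumChannel E ∧ IsStrictlyContractive E}

/-- All non-unital strictly contractive quantum channels. -/
def nonunitalContractiveNoise (N : ℕ) : Set (Op N →ₗ[ℂ] Op N) :=
  {E | IsQuantumChannel E ∧ IsStrictlyContractive E ∧ ¬ IsUnital E}

/-- Amplitude damping of strength `γ` on every qubit of a non-empty register. -/
def dampingNoise (γ : ℝ) (N : ℕ) : Set (Op N →ₗ[ℂ] Op N) :=
  {E | 0 < N ∧ E = amplitudeDamping γ N}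

end

end QESN

namespace QESN

noncomputable section

open scoped MatrixOrder ComplexOrder

/-! ### The trace norm of Hermitian operators -/

section TraceNorm

variable {N : ℕ}

/-! Echo states come from contraction and compactness. Unitaries and measurements do not expand the
trace norm, so each step contracts distances by the factor `r` of the noise. Two trajectories whose
inputs agree up to a time are therefore within `2 * r ^ k` of each other at that time for every `k`,
so they coincide (`Network.IsTrajectory.eq_of_agree`). Existence follows from compactness of the
space of sequences of density operators, and continuity in the input from the trajectory relation
being closed. For causal functionals, `d_ω`-continuity is the same as continuity in the product
topology.

Universality is Stone–Weierstrass on the compact space of pasts: multiplexing turns the outputs into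
an algebra, which must contain the constants and separate points (`isUniversal_of_separating`). One
measured qubit suffices. After measurement its state is diagonal, hence described by `z = ⟨Z⟩`, and
a suitable rotation makes `z` evolve by `z ↦ c + k sin (α x + β) z`
(`HasInputDependentFixedPoint.exists_gates`). If `c` were `0`, the maximally mixed state would be
fixed for all inputs; if no rotation gave `k ≠ 0`, the measured state would ignore the input.
Input-dependent fixed points exclude both. Zero angles give constants. With `α = β = δ`, equal
outputs can be traced back to the latest time at which two pasts differ, where the term of first
order in `δ` recovers the input value (`exists_separating`).

For amplitude damping, every output state has a component on the ground state. Two outputs thus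
never become perfectly distinguishable, and compactness upgrades this to a uniform contraction
factor. An `RY` gate of angle `x` gives the fixed points `z = γ / (1 - (1 - γ) cos x)`, distinct for
distinct `x` in `[0,1]`. -/

lemma re_trace_nonneg {A : Op N} (hA : A.PosSemidef) : 0 ≤ A.trace.re :=
  (Complex.le_def.mp hA.trace_nonneg).1

lemma re_trace_mul_nonneg {A B : Op N} (hA : A.PosSemidef) (hB : B.PosSemidef) :
    0 ≤ (A * B).trace.re := by
  obtain ⟨C, rfl⟩ : ∃ C : Op N, A = C.conjTranspose * C :=
    CStarAlgebra.nonneg_iff_eq_star_mul_self.mp (Matrix.nonneg_iff_posSemidef.mpr hA)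
  rw [Matrix.mul_assoc, Matrix.trace_mul_comm]
  exact re_trace_nonneg (hB.mul_mul_conjTranspose_same C)

lemma traceNorm_eq_abs (A : Op N) : traceNorm A = (CFC.abs A).trace.re := rfl

lemma exists_jordan {A : Op N} (hA : A.IsHermitian) :
    ∃ P Q : Op N, P.PosSemidef ∧ Q.PosSemidef ∧ A = P - Q ∧
      traceNorm A = P.trace.re + Q.trace.re := by
  have hA' : IsSelfAdjoint A := hA
  refine ⟨A⁺, A⁻, Matrix.nonneg_iff_posSemidef.mp (CFC.posPart_nonneg A),
    Matrix.nonneg_iff_posSemidef.mp (CFC.negPart_nonneg A),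
    (CFC.posPart_sub_negPart A hA').symm, ?_⟩
  rw [traceNorm_eq_abs, ← CFC.posPart_add_negPart A hA', Matrix.trace_add, Complex.add_re]

/-- Hermitian contractions `-1 ≤ S ≤ 1`, which are dual to the trace norm. -/
def IsHermitianContraction (S : Op N) : Prop := (1 - S).PosSemidef ∧ (1 + S).PosSemidef

/-- The optimal `S` is `sign A`, since `x * sign x = |x|`. The functional calculus applies to the
discontinuous sign because the spectrum is finite. -/
lemma exists_sign {A : Op N} (hA : A.IsHermitian) :
    ∃ S : Op N, IsHermitianContraction S ∧ traceNorm A = (A * S).trace.re := by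
  have hA' : IsSelfAdjoint A := hA
  have hc : ∀ f : ℝ → ℝ, ContinuousOn f (spectrum ℝ A) := fun f =>
    (Matrix.finite_real_spectrum (A := A)).continuousOn f
  refine ⟨cfc (fun x : ℝ => (SignType.sign x : ℝ)) A, ⟨?_, ?_⟩, ?_⟩
  · rw [← Matrix.nonneg_iff_posSemidef, ← cfc_one (R := ℝ) A hA', ← cfc_sub _ _ A (hc _) (hc _)]
    refine cfc_nonneg fun x _ => ?_
    rcases lt_trichotomy x 0 with h | h | h <;> simp [h]
  · rw [← Matrix.nonneg_iff_posSemidef, ← cfc_one (R := ℝ) A hA', ← cfc_add A _ _ (hc _) (hc _)]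
    refine cfc_nonneg fun x _ => ?_
    rcases lt_trichotomy x 0 with h | h | h <;> simp [h]
  · rw [traceNorm_eq_abs, CFC.abs_eq_cfc_norm A hA']
    conv_rhs => enter [1, 1, 1]; rw [← cfc_id' ℝ A hA']
    rw [← cfc_mul _ _ A (hc _) (hc _)]
    congr 3
    ext x
    rw [Real.norm_eq_abs, self_mul_sign]

lemma re_trace_mul_le {P S : Op N} (hP : P.PosSemidef) (hS : IsHermitianContraction S) :
    (P * S).trace.re ≤ P.trace.re ∧ -P.trace.re ≤ (P * S).trace.re := by
  have h1 := re_trace_mul_nonneg hP hS.1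
  have h2 := re_trace_mul_nonneg hP hS.2
  simp only [Matrix.mul_sub, Matrix.mul_add, Matrix.mul_one, Matrix.trace_sub, Matrix.trace_add,
    Complex.sub_re, Complex.add_re] at h1 h2
  constructor <;> linarith

/-- Plays the role of the triangle inequality: paired with the sign of `P - Q`, each term
contributes at most its trace. -/
lemma traceNorm_sub_le {P Q : Op N} (hP : P.PosSemidef) (hQ : Q.PosSemidef) :
    traceNorm (P - Q) ≤ P.trace.re + Q.trace.re := by
  obtain ⟨S, hS, h⟩ := exists_sign (hP.isHermitian.sub hQ.isHermitian)
  rw [h, Matrix.sub_mul, Matrix.trace_sub, Complex.sub_re]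
  have h1 := re_trace_mul_le hP hS
  have h2 := re_trace_mul_le hQ hS
  linarith

lemma traceNorm_nonneg {A : Op N} (hA : A.IsHermitian) : 0 ≤ traceNorm A := by
  obtain ⟨P, Q, hP, hQ, -, h⟩ := exists_jordan hA
  rw [h]
  exact add_nonneg (re_trace_nonneg hP) (re_trace_nonneg hQ)

lemma PosSemidef.eq_zero_of_re_trace {P : Op N} (hP : P.PosSemidef) (h : P.trace.re = 0) :
    P = 0 := by
  refine hP.trace_eq_zero_iff.mp (Complex.ext h ?_)
  exact (Complex.le_def.mp hP.trace_nonneg).2.symm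

lemma eq_zero_of_traceNorm {A : Op N} (hA : A.IsHermitian) (h0 : traceNorm A ≤ 0) : A = 0 := by
  obtain ⟨P, Q, hP, hQ, rfl, h⟩ := exists_jordan hA
  have h1 := re_trace_nonneg hP
  have h2 := re_trace_nonneg hQ
  rw [PosSemidef.eq_zero_of_re_trace hP (by linarith),
    PosSemidef.eq_zero_of_re_trace hQ (by linarith), sub_zero]

/-- A matrix entry of a positive operator is bounded by the trace. -/
lemma norm_apply_le_re_trace {P : Op N} (hP : P.PosSemidef) (i j : Fin N → Fin 2) :
    ‖P i j‖ ≤ P.trace.re := by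
  have hd : ∀ k, 0 ≤ (P k k).re := fun k => (Complex.le_def.mp (hP.diag_nonneg (i := k))).1
  have him : ∀ k, (P k k).im = 0 := fun k => (Complex.le_def.mp (hP.diag_nonneg (i := k))).2.symm
  have htr : ∀ k, (P k k).re ≤ P.trace.re := fun k => by
    rw [Matrix.trace, Complex.re_sum]
    exact Finset.single_le_sum (f := fun k => (P k k).re) (fun k _ => hd k) (Finset.mem_univ k)
  -- The minor on `i, j` gives `|P i j|² ≤ P i i * P j j`; the repeated index `i = j` does no harm.
  have hdet := (hP.submatrix ![i, j]).det_nonneg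
  rw [Matrix.det_fin_two] at hdet
  simp only [Matrix.submatrix_apply, Matrix.cons_val_zero, Matrix.cons_val_one] at hdet
  have hji : P j i = star (P i j) := (hP.isHermitian.apply j i).symm
  have h1 := (Complex.le_def.mp hdet).1
  rw [hji] at h1
  simp only [Complex.zero_re, Complex.sub_re, Complex.mul_re, him, Complex.star_def,
    Complex.conj_re, Complex.conj_im] at h1
  have h2 : ‖P i j‖ ^ 2 = (P i j).re * (P i j).re + (P i j).im * (P i j).im := by
    rw [← Complex.normSq_apply, Complex.normSq_eq_norm_sq]
  have h3 : ‖P i j‖ ^ 2 ≤ P.trace.re ^ 2 := by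
    nlinarith [htr i, htr j, hd i, hd j, mul_le_mul (htr i) (htr j) (hd j) ((hd i).trans (htr i))]
  exact abs_le_of_sq_le_sq' h3 ((hd i).trans (htr i)) |>.2

end TraceNorm

/-! ### Kraus maps and density operators -/

section Kraus

variable {N : ℕ} {ι : Type} [Fintype ι]

lemma krausMap_apply (K : ι → Op N) (A : Op N) :
    krausMap K A = ∑ a, K a * A * (K a).conjTranspose := by
  simp [krausMap, LinearMap.sum_apply]

lemma krausMap_posSemidef (K : ι → Op N) {A : Op N} (hA : A.PosSemidef) :
    (krausMap K A).PosSemidef := by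
  rw [krausMap_apply]
  exact Matrix.posSemidef_sum _ fun a _ => hA.mul_mul_conjTranspose_same (K a)

lemma krausMap_trace {K : ι → Op N} (hK : ∑ a, (K a).conjTranspose * K a = 1) (A : Op N) :
    (krausMap K A).trace = A.trace := by
  rw [krausMap_apply, Matrix.trace_sum]
  calc ∑ a, (K a * A * (K a).conjTranspose).trace
      = ∑ a, ((K a).conjTranspose * K a * A).trace := by
        refine Finset.sum_congr rfl fun a _ => ?_
        rw [Matrix.trace_mul_comm, Matrix.mul_assoc]
    _ = A.trace := by rw [← Matrix.trace_sum, ← Finset.sum_mul, hK, Matrix.one_mul]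

lemma IsDensity.krausMap {K : ι → Op N} (hK : ∑ a, (K a).conjTranspose * K a = 1) {ρ : Op N}
    (hρ : IsDensity ρ) : IsDensity (krausMap K ρ) :=
  ⟨krausMap_posSemidef K hρ.1, by rw [krausMap_trace hK, hρ.2]⟩

/-- A positive trace-preserving map sends the Jordan parts of `A` to positive operators with the
same traces, whose difference may have smaller trace norm. -/
lemma traceNorm_krausMap_le {K : ι → Op N} (hK : ∑ a, (K a).conjTranspose * K a = 1) {A : Op N}
    (hA : A.IsHermitian) : traceNorm (QESN.krausMap K A) ≤ traceNorm A := by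
  obtain ⟨P, Q, hP, hQ, h, h'⟩ := exists_jordan hA
  rw [h', h, map_sub, ← krausMap_trace hK P, ← krausMap_trace hK Q]
  exact traceNorm_sub_le (krausMap_posSemidef K hP) (krausMap_posSemidef K hQ)

lemma IsDensity.sub_isHermitian {ρ σ : Op N} (hρ : IsDensity ρ) (hσ : IsDensity σ) :
    (ρ - σ).IsHermitian := hρ.1.isHermitian.sub hσ.1.isHermitian

lemma IsDensity.traceNorm_sub_le_two {ρ σ : Op N} (hρ : IsDensity ρ) (hσ : IsDensity σ) :
    traceNorm (ρ - σ) ≤ 2 := by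
  have := traceNorm_sub_le hρ.1 hσ.1
  rw [hρ.2, hσ.2] at this
  norm_num at this
  exact this

lemma IsQuantumChannel.isDensity {E : Op N →ₗ[ℂ] Op N} (hE : IsQuantumChannel E) {ρ : Op N}
    (hρ : IsDensity ρ) : IsDensity (E ρ) := by
  obtain ⟨r, K, hK, rfl⟩ := hE
  exact hρ.krausMap hK

lemma isClosed_posSemidef : IsClosed {A : Op N | A.PosSemidef} := by
  have : {A : Op N | A.PosSemidef} = {A : Op N | A.IsHermitian} ∩
      ⋂ x : (Fin N → Fin 2) → ℂ, {A : Op N | 0 ≤ star x ⬝ᵥ (A.mulVec x)} := by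
    ext A
    simp [Matrix.posSemidef_iff_dotProduct_mulVec]
  rw [this]
  refine IsClosed.inter ?_ (isClosed_iInter fun x => ?_)
  · exact isClosed_eq (by fun_prop) continuous_id
  · exact isClosed_le continuous_const (by fun_prop)

lemma isCompact_isDensity : IsCompact {ρ : Op N | IsDensity ρ} := by
  have hK : IsCompact (Set.univ.pi fun _ : Fin N → Fin 2 =>
      Set.univ.pi fun _ : Fin N → Fin 2 => Metric.closedBall (0 : ℂ) 1) :=
    isCompact_univ_pi fun _ => isCompact_univ_pi fun _ => isCompact_closedBall 0 1
  refine hK.of_isClosed_subset ?_ ?_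
  · exact isClosed_posSemidef.inter (isClosed_eq (by fun_prop) continuous_const)
  · intro ρ hρ i _ j _
    simpa [hρ.2] using norm_apply_le_re_trace hρ.1 i j

lemma exists_isDensity (N : ℕ) : ∃ ρ : Op N, IsDensity ρ := by
  refine ⟨Matrix.diagonal fun i => if i = 0 then 1 else 0, Matrix.PosSemidef.diagonal ?_, ?_⟩
  · intro i
    by_cases h : i = 0 <;> simp [h]
  · simp [Matrix.trace_diagonal]

end Kraus

/-! ### Unitarity of encoding circuits -/

section Circuits

variable {N : ℕ}

lemma onQubit_apply (s : Fin N) (A : Matrix (Fin 2) (Fin 2) ℂ) (i j : Fin N → Fin 2) :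
    onQubit s A i j = if ∀ k, k ≠ s → i k = j k then A (i s) (j s) else 0 := rfl

lemma onQubit_conjTranspose (s : Fin N) (A : Matrix (Fin 2) (Fin 2) ℂ) :
    (onQubit s A).conjTranspose = onQubit s A.conjTranspose := by
  ext i j
  rw [Matrix.conjTranspose_apply, onQubit_apply, onQubit_apply]
  by_cases h : ∀ k, k ≠ s → i k = j k
  · rw [if_pos h, if_pos fun k hk => (h k hk).symm, Matrix.conjTranspose_apply]
  · rw [if_neg h, if_neg fun h' => h fun k hk => (h' k hk).symm, star_zero]

lemma onQubit_one (s : Fin N) : onQubit s 1 = 1 := by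
  ext i j
  rw [onQubit_apply]
  by_cases h : i = j
  · subst h; simp
  · rw [Matrix.one_apply_ne h]
    split_ifs with h'
    · refine Matrix.one_apply_ne fun h'' => h (funext fun k => ?_)
      by_cases hk : k = s
      · rw [hk, h'']
      · exact h' k hk
    · rfl

lemma onQubit_mul (s : Fin N) (A B : Matrix (Fin 2) (Fin 2) ℂ) :
    onQubit s A * onQubit s B = onQubit s (A * B) := by
  ext i j
  rw [Matrix.mul_apply, onQubit_apply, Matrix.mul_apply]
  have hinj : Function.Injective (Function.update i s) := Function.update_injective i s
  -- Only intermediate bit strings that differ from `i` at most at `s` contribute; they are indexed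
  -- by their bit at `s`.
  rw [← Finset.sum_subset (Finset.subset_univ (Finset.univ.map ⟨_, hinj⟩)), Finset.sum_map]
  · simp only [Function.Embedding.coeFn_mk]
    split_ifs with h
    · refine Finset.sum_congr rfl fun b _ => ?_
      rw [onQubit_apply, onQubit_apply, if_pos, if_pos]
      · simp
      · intro k hk; simp [hk, h k hk]
      · intro k hk; simp [hk]
    · refine Finset.sum_eq_zero fun b _ => ?_
      rw [onQubit_apply (i := Function.update i s b), if_neg, mul_zero]
      intro h'
      refine h fun k hk => ?_
      simpa [hk] using h' k hk
  · intro k _ hk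
    rw [onQubit_apply, if_neg, zero_mul]
    intro h
    refine hk (Finset.mem_map.mpr ⟨k s, Finset.mem_univ _, ?_⟩)
    funext l
    by_cases hl : l = s
    · subst hl; simp
    · simp [hl, h l hl]

lemma rotX_unitary (θ : ℝ) : (rotX θ).conjTranspose * rotX θ = 1 := by
  have h := Complex.ofReal_inj.mpr (Real.cos_sq_add_sin_sq (θ / 2))
  push_cast at h
  ext i j
  fin_cases i <;> fin_cases j <;>
    simp [rotX, Matrix.mul_apply, Fin.sum_univ_two, -Complex.ofReal_cos, -Complex.ofReal_sin] <;>
    push_cast <;>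
    first
    | linear_combination (-Complex.sin (θ / 2) ^ 2) * Complex.I_sq + h
    | ring

lemma rotY_unitary (θ : ℝ) : (rotY θ).conjTranspose * rotY θ = 1 := by
  have h := Complex.ofReal_inj.mpr (Real.cos_sq_add_sin_sq (θ / 2))
  push_cast at h
  ext i j
  fin_cases i <;> fin_cases j <;>
    simp [rotY, Matrix.mul_apply, Fin.sum_univ_two, -Complex.ofReal_cos, -Complex.ofReal_sin] <;>
    push_cast <;> first | linear_combination h | ring

lemma rotZ_unitary (θ : ℝ) : (rotZ θ).conjTranspose * rotZ θ = 1 := by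
  ext i j
  fin_cases i <;> fin_cases j <;>
    simp [rotZ, Matrix.mul_apply, Fin.sum_univ_two, ← Complex.exp_conj, ← Complex.exp_add, map_ofNat]

lemma cnotMatrix_apply (c t : Fin N) (i j : Fin N → Fin 2) :
    cnotMatrix c t i j = if i = Function.update j t (j t + j c) then 1 else 0 := rfl

lemma cnotMatrix_unitary {c t : Fin N} (h : c ≠ t) :
    (cnotMatrix c t).conjTranspose * cnotMatrix c t = 1 := by
  -- CNOT permutes the basis by an involution: the control bit is unchanged and is added twice
  -- modulo 2.
  have hinv : Function.Involutive fun j : Fin N → Fin 2 => Function.update j t (j t + j c) := by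
    intro j
    funext k
    by_cases hk : k = t
    · subst hk
      simp only [Function.update_self, Function.update_of_ne h]
      generalize j k = a
      generalize j c = b
      revert a b
      decide
    · simp [hk]
  ext i j
  rw [Matrix.mul_apply, Finset.sum_eq_single (Function.update j t (j t + j c))]
  · rw [Matrix.conjTranspose_apply, cnotMatrix_apply, cnotMatrix_apply, if_pos rfl, mul_one,
      Matrix.one_apply]
    by_cases hij : i = j
    · simp [hij]
    · rw [if_neg hij, if_neg, star_zero]
      exact fun h' => hij (hinv.injective h').symm
  · intro k _ hk
    rw [cnotMatrix_apply c t k j, if_neg hk, mul_zero]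
  · simp

lemma Gate.unitary (x : ℝ) (g : Gate N) : (g.matrix x).conjTranspose * g.matrix x = 1 := by
  cases g with
  | rx s α β => simp only [Gate.matrix, onQubit_conjTranspose, onQubit_mul, rotX_unitary, onQubit_one]
  | ry s α β => simp only [Gate.matrix, onQubit_conjTranspose, onQubit_mul, rotY_unitary, onQubit_one]
  | rz s α β => simp only [Gate.matrix, onQubit_conjTranspose, onQubit_mul, rotZ_unitary, onQubit_one]
  | cnot c t h => exact cnotMatrix_unitary h

lemma circuitUnitary_unitary (x : ℝ) (C : Circuit N) :
    (circuitUnitary x C).conjTranspose * circuitUnitary x C = 1 := by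
  induction C with
  | nil => simp [circuitUnitary]
  | cons g gs ih =>
    rw [circuitUnitary, Matrix.conjTranspose_mul, Matrix.mul_assoc,
      ← Matrix.mul_assoc _ (circuitUnitary x gs), ih, Matrix.one_mul, Gate.unitary]

lemma continuous_onQubit {X : Type*} [TopologicalSpace X] (s : Fin N)
    {A : X → Matrix (Fin 2) (Fin 2) ℂ} (hA : Continuous A) : Continuous fun x => onQubit s (A x) := by
  refine continuous_matrix fun i j => ?_
  simp only [onQubit_apply]
  split_ifs
  · exact hA.matrix_elem _ _
  · exact continuous_const

lemma Gate.continuous_matrix (g : Gate N) : Continuous fun x : ℝ => g.matrix x := by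
  cases g with
  | rx s α β =>
    refine continuous_onQubit s (_root_.continuous_matrix fun i j => ?_)
    fin_cases i <;> fin_cases j <;> simp [rotX] <;> fun_prop
  | ry s α β =>
    refine continuous_onQubit s (_root_.continuous_matrix fun i j => ?_)
    fin_cases i <;> fin_cases j <;> simp [rotY] <;> fun_prop
  | rz s α β =>
    refine continuous_onQubit s (_root_.continuous_matrix fun i j => ?_)
    fin_cases i <;> fin_cases j <;> simp [rotZ] <;> fun_prop
  | cnot c t h => exact continuous_const

lemma continuous_circuitUnitary (C : Circuit N) : Continuous fun x : ℝ => circuitUnitary x C := by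
  induction C with
  | nil => exact continuous_const
  | cons g gs ih => exact ih.mul g.continuous_matrix

/-! ### One time step -/

lemma midMeasure_eq_krausMap (M : Finset (Fin N)) (ρ : Op N) :
    midMeasure M ρ = krausMap (outcomeProj M) ρ := by
  rw [krausMap_apply, midMeasure]

lemma outcomeProj_complete (M : Finset (Fin N)) :
    ∑ m, (outcomeProj M m).conjTranspose * outcomeProj M m = 1 := by
  simp only [outcomeProj, Matrix.diagonal_conjTranspose, Matrix.diagonal_mul_diagonal]
  ext i j
  rw [Matrix.sum_apply]
  by_cases h : i = j
  · subst h
    simp only [Matrix.diagonal_apply_eq, Matrix.one_apply_eq, Pi.star_apply]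
    rw [Finset.sum_eq_single fun s : M => i s]
    · simp
    · intro m _ hm
      rw [if_neg fun h => hm (funext fun s => (h s).symm), mul_zero]
    · simp
  · simp [h]

lemma conj_eq_krausMap (U ρ : Op N) :
    U * ρ * U.conjTranspose = krausMap (fun _ : Unit => U) ρ := by
  simp [krausMap_apply]

lemma step_isDensity {E : Op N →ₗ[ℂ] Op N} (hE : IsQuantumChannel E) (C : Circuit N)
    (M : Finset (Fin N)) (x : ℝ) {ρ : Op N} (hρ : IsDensity ρ) : IsDensity (step C E M x ρ) := by
  rw [step, midMeasure_eq_krausMap, conj_eq_krausMap]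
  refine (hE.isDensity (hρ.krausMap ?_)).krausMap (outcomeProj_complete M)
  simp [circuitUnitary_unitary]

lemma traceNorm_step_le {E : Op N →ₗ[ℂ] Op N} (hE : IsQuantumChannel E) {r : ℝ} (hr0 : 0 ≤ r)
    (hr : ∀ ρ σ : Op N, IsDensity ρ → IsDensity σ →
      traceNorm (E ρ - E σ) ≤ r * traceNorm (ρ - σ)) (C : Circuit N) (M : Finset (Fin N)) (x : ℝ)
    {ρ σ : Op N} (hρ : IsDensity ρ) (hσ : IsDensity σ) :
    traceNorm (step C E M x ρ - step C E M x σ) ≤ r * traceNorm (ρ - σ) := by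
  have hU : ∑ _a : Unit, (circuitUnitary x C).conjTranspose * circuitUnitary x C = 1 := by
    simp [circuitUnitary_unitary]
  simp only [step, midMeasure_eq_krausMap, conj_eq_krausMap]
  have h1 := hρ.krausMap hU
  have h2 := hσ.krausMap hU
  rw [← map_sub]
  refine (traceNorm_krausMap_le (outcomeProj_complete M)
    ((hE.isDensity h1).sub_isHermitian (hE.isDensity h2))).trans ((hr _ _ h1 h2).trans ?_)
  rw [← map_sub]
  exact mul_le_mul_of_nonneg_left (traceNorm_krausMap_le hU (hρ.sub_isHermitian hσ)) hr0

lemma continuous_krausMap {ι : Type} [Fintype ι] (K : ι → Op N) :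
    Continuous fun A => krausMap K A := by
  simp only [krausMap_apply]
  fun_prop

lemma IsQuantumChannel.continuous {E : Op N →ₗ[ℂ] Op N} (hE : IsQuantumChannel E) :
    Continuous E := by
  obtain ⟨r, K, -, rfl⟩ := hE
  exact continuous_krausMap K

lemma continuous_step {E : Op N →ₗ[ℂ] Op N} (hE : IsQuantumChannel E) (C : Circuit N)
    (M : Finset (Fin N)) : Continuous fun p : ℝ × Op N => step C E M p.1 p.2 := by
  simp only [step, midMeasure_eq_krausMap]
  have hU := (continuous_circuitUnitary C).comp (continuous_fst (X := ℝ) (Y := Op N))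
  refine (continuous_krausMap _).comp (hE.continuous.comp ?_)
  exact (hU.mul continuous_snd).mul hU.matrix_conjTranspose

end Circuits

/-! ### Trajectories of networks with strictly contractive noise -/

namespace Network

variable {R : Network}

/-- States `k` steps earlier are at distance at most `2`, and the common inputs since then contract
this to `r ^ k * 2`. This yields both uniqueness of trajectories and causality. -/
lemma IsTrajectory.eq_of_agree (hR : R.noise ∈ contractiveNoise R.qubits) {u v : Input} {t₀ : ℤ}
    (huv : ∀ s, s ≤ t₀ → u s = v s) {ρ σ : ℤ → Op R.qubits} (hρ : R.IsTrajectory u ρ)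
    (hσ : R.IsTrajectory v σ) : ρ t₀ = σ t₀ := by
  obtain ⟨hE, r', hr1', hr'⟩ := hR
  -- Strict contractivity does not require a nonnegative constant; replacing it by its maximum with
  -- `0` makes the powers `r ^ k` usable.
  obtain ⟨r, hr0, hr1, hr⟩ : ∃ r : ℝ, 0 ≤ r ∧ r < 1 ∧ ∀ ρ σ : Op R.qubits, IsDensity ρ →
      IsDensity σ → traceNorm (R.noise ρ - R.noise σ) ≤ r * traceNorm (ρ - σ) :=
    ⟨max r' 0, le_max_right _ _, max_lt hr1' one_pos, fun ρ σ hρ hσ => (hr' ρ σ hρ hσ).trans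
      (mul_le_mul_of_nonneg_right (le_max_left _ _) (traceNorm_nonneg (hρ.sub_isHermitian hσ)))⟩
  have key : ∀ k : ℕ, ∀ t ≤ t₀, traceNorm (ρ t - σ t) ≤ r ^ k * 2 := by
    intro k
    induction k with
    | zero =>
      intro t _
      simpa using (hρ.1 t).traceNorm_sub_le_two (hσ.1 t)
    | succ k ih =>
      intro t ht
      have h1 := hρ.2 (t - 1)
      have h2 := hσ.2 (t - 1)
      rw [sub_add_cancel] at h1 h2
      rw [h1, h2, huv t ht, pow_succ', mul_assoc]
      exact (traceNorm_step_le hE hr0 hr _ _ _ (hρ.1 _) (hσ.1 _)).trans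
        (mul_le_mul_of_nonneg_left (ih (t - 1) (by omega)) hr0)
  have hlim : Filter.Tendsto (fun k : ℕ => r ^ k * 2) Filter.atTop (nhds 0) := by
    simpa using (tendsto_pow_atTop_nhds_zero_of_lt_one hr0 hr1).mul_const 2
  exact sub_eq_zero.mp (eq_zero_of_traceNorm ((hρ.1 t₀).sub_isHermitian (hσ.1 t₀))
    (ge_of_tendsto' hlim fun k => key k t₀ le_rfl))

lemma isCompact_densitySequences (N : ℕ) : IsCompact {ρ : ℤ → Op N | ∀ t, IsDensity (ρ t)} := by
  have := isCompact_univ_pi fun _ : ℤ => isCompact_isDensity (N := N)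
  simpa [Set.pi] using this

lemma isClosed_densitySequences (N : ℕ) : IsClosed {ρ : ℤ → Op N | ∀ t, IsDensity (ρ t)} :=
  (isCompact_densitySequences N).isClosed

lemma isClosed_recursion (hE : IsQuantumChannel R.noise) (t : ℤ) :
    IsClosed {p : Input × (ℤ → Op R.qubits) |
      p.2 (t + 1) = step R.circuit R.noise R.measured (p.1 (t + 1)) (p.2 t)} := by
  have h : Continuous fun p : Input × (ℤ → Op R.qubits) => ((p.1 (t + 1) : ℝ), p.2 t) := by
    fun_prop
  have h' := (continuous_step hE R.circuit R.measured).comp h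
  exact isClosed_eq ((continuous_apply (t + 1)).comp continuous_snd) h'

lemma isClosed_isTrajectory (hE : IsQuantumChannel R.noise) :
    IsClosed {p : Input × (ℤ → Op R.qubits) | R.IsTrajectory p.1 p.2} := by
  have h : {p : Input × (ℤ → Op R.qubits) | R.IsTrajectory p.1 p.2} =
      Prod.snd ⁻¹' {ρ | ∀ t, IsDensity (ρ t)} ∩ ⋂ t : ℤ, {p : Input × (ℤ → Op R.qubits) | p.2 (t + 1) =
        step R.circuit R.noise R.measured (p.1 (t + 1)) (p.2 t)} := by
    ext p
    simp [IsTrajectory]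
  rw [h]
  exact ((isClosed_densitySequences _).preimage continuous_snd).inter
    (isClosed_iInter fun t => isClosed_recursion hE t)

/-- Sequences that obey the dynamics from a given time on exist for every initial state. -/
lemma exists_forward_trajectory (hE : IsQuantumChannel R.noise) (u : Input) (t₀ : ℤ) :
    ∃ ρ : ℤ → Op R.qubits, (∀ t, IsDensity (ρ t)) ∧ ∀ t, t₀ ≤ t →
      ρ (t + 1) = step R.circuit R.noise R.measured (u (t + 1)) (ρ t) := by
  obtain ⟨ρ₀, hρ₀⟩ := exists_isDensity R.qubits
  let σ : ℕ → Op R.qubits := fun k => Nat.rec ρ₀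
    (fun k ρ => step R.circuit R.noise R.measured (u (t₀ + k + 1)) ρ) k
  have hσ : ∀ k, IsDensity (σ k) := by
    intro k
    induction k with
    | zero => exact hρ₀
    | succ k ih => exact step_isDensity hE _ _ _ ih
  refine ⟨fun t => σ (t - t₀).toNat, fun t => hσ _, fun t ht => ?_⟩
  obtain ⟨k, rfl⟩ := Int.le.dest ht
  have h1 : (t₀ + k + 1 - t₀).toNat = k + 1 := by omega
  have h2 : (t₀ + k - t₀).toNat = k := by omega
  simp only [h1, h2]
  rfl

/-- Sequences obeying the dynamics from time `-n` on form nonempty compact sets that decrease with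
`n`; a point of their intersection is a trajectory on all of `ℤ`. -/
lemma exists_isTrajectory (hE : IsQuantumChannel R.noise) (u : Input) :
    ∃ ρ, R.IsTrajectory u ρ := by
  let T : ℕ → Set (ℤ → Op R.qubits) := fun n => {ρ | ∀ t, IsDensity (ρ t)} ∩
    {ρ | ∀ t, -(n : ℤ) ≤ t → ρ (t + 1) = step R.circuit R.noise R.measured (u (t + 1)) (ρ t)}
  have hcl : ∀ n, IsClosed (T n) := by
    intro n
    refine (isClosed_densitySequences _).inter ?_
    simp only [Set.ofPred_forall]
    refine isClosed_iInter fun t => isClosed_iInter fun _ => ?_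
    exact (isClosed_recursion hE t).preimage (Continuous.prodMk_right u)
  obtain ⟨ρ, hρ⟩ := IsCompact.nonempty_iInter_of_sequence_nonempty_isCompact_isClosed T
    (fun n ρ hρ => ⟨hρ.1, fun t ht => hρ.2 t (by push_cast; omega)⟩)
    (fun n => (exists_forward_trajectory hE u (-n)).imp fun ρ hρ => hρ)
    ((isCompact_densitySequences _).of_isClosed_subset (hcl 0) Set.inter_subset_left) hcl
  rw [Set.mem_iInter] at hρ
  exact ⟨ρ, (hρ 0).1, fun t => (hρ t.natAbs).2 t (by omega)⟩

lemma echoState_of_contractive (hR : R.noise ∈ contractiveNoise R.qubits) : R.EchoState := by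
  intro u
  obtain ⟨ρ, hρ⟩ := exists_isTrajectory hR.1 u
  exact ⟨ρ, hρ, fun σ hσ => funext fun t => hσ.eq_of_agree hR (fun _ _ => rfl) hρ⟩

lemma filter_eq (hR : R.noise ∈ contractiveNoise R.qubits) {u : Input} {ρ : ℤ → Op R.qubits}
    (hρ : R.IsTrajectory u ρ) (t : ℤ) : R.filter u t = R.readout (ρ t) := by
  have h : ∃ ρ, R.IsTrajectory u ρ := ⟨ρ, hρ⟩
  rw [filter, dif_pos h, h.choose_spec.eq_of_agree hR (fun _ _ => rfl) hρ]

lemma filter_causal (hR : R.noise ∈ contractiveNoise R.qubits) (u v : Input) (t : ℤ)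
    (huv : ∀ s, s ≤ t → u s = v s) : R.filter u t = R.filter v t := by
  obtain ⟨ρ, hρ⟩ := exists_isTrajectory hR.1 u
  obtain ⟨σ, hσ⟩ := exists_isTrajectory hR.1 v
  rw [filter_eq hR hρ, filter_eq hR hσ, hρ.eq_of_agree hR huv hσ]

lemma filter_shift (hR : R.noise ∈ contractiveNoise R.qubits) (τ : ℤ) (u : Input) (t : ℤ) :
    R.filter (shift τ u) t = R.filter u (t + τ) := by
  obtain ⟨ρ, hρ⟩ := exists_isTrajectory hR.1 u
  have hσ : R.IsTrajectory (shift τ u) fun t => ρ (t + τ) := by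
    refine ⟨fun t => hρ.1 _, fun t => ?_⟩
    have := hρ.2 (t + τ)
    rw [add_right_comm] at this
    exact this
  rw [filter_eq hR hρ, filter_eq hR hσ]

lemma continuous_readout (R : Network) : Continuous R.readout := by
  unfold readout
  fun_prop

/-- The output of the network at time `0` depends continuously on the input in the product
topology: the set of all trajectories is closed and the state space is compact. -/
lemma continuous_filter (hR : R.noise ∈ contractiveNoise R.qubits) :
    Continuous fun u : Input => R.filter u 0 := by
  choose T hT using exists_isTrajectory (R := R) hR.1
  have hTc : Continuous T := by
    rw [continuous_iff_ultrafilter]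
    intro u g hg
    -- Compactness supplies a limit along the ultrafilter, closedness makes it a trajectory of `u`,
    -- and uniqueness identifies it with `T u`.
    obtain ⟨ρ, -, hρ⟩ := (isCompact_densitySequences R.qubits).ultrafilter_le_nhds (g.map T)
      (Filter.le_principal_iff.mpr (Filter.Eventually.of_forall (f := (g : Filter Input))
        fun v => (hT v).1))
    have hlim : Filter.Tendsto (fun v => (v, T v)) g (nhds (u, ρ)) :=
      Filter.Tendsto.prodMk_nhds hg hρ
    have hρu : R.IsTrajectory u ρ := (isClosed_isTrajectory hR.1).mem_of_tendsto hlim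
      (Filter.Eventually.of_forall hT)
    rwa [(echoState_of_contractive hR u).unique (hT u) hρu]
  have : (fun u : Input => R.filter u 0) = fun u => R.readout (T u 0) :=
    funext fun u => filter_eq hR (hT u) 0
  rw [this]
  exact R.continuous_readout.comp ((continuous_apply 0).comp hTc)

end Network

/-! ### Multiplexed networks with strictly contractive noise -/

namespace Multiplexed

lemma UsesNoise.mono {𝒩 𝒩' : ∀ N : ℕ, Set (Op N →ₗ[ℂ] Op N)} (h : ∀ N, 𝒩 N ⊆ 𝒩' N) :
    ∀ {A : Multiplexed}, A.UsesNoise 𝒩 → A.UsesNoise 𝒩'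
  | single R, hA => h R.qubits hA
  | sum _ _, hA => ⟨hA.1.mono h, hA.2.mono h⟩
  | prod _ _, hA => ⟨hA.1.mono h, hA.2.mono h⟩

lemma UsesNoise.echoState :
    ∀ {A : Multiplexed}, A.UsesNoise contractiveNoise → A.EchoState
  | single _, hA => Network.echoState_of_contractive hA
  | sum _ _, hA => ⟨hA.1.echoState, hA.2.echoState⟩
  | prod _ _, hA => ⟨hA.1.echoState, hA.2.echoState⟩

lemma UsesNoise.filter_causal : ∀ {A : Multiplexed}, A.UsesNoise contractiveNoise →
    ∀ (u v : Input) (t : ℤ), (∀ s, s ≤ t → u s = v s) → A.filter u t = A.filter v t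
  | single _, hA, u, v, t, h => Network.filter_causal hA u v t h
  | sum _ _, hA, u, v, t, h =>
    congrArg₂ (· + ·) (hA.1.filter_causal u v t h) (hA.2.filter_causal u v t h)
  | prod _ _, hA, u, v, t, h =>
    congrArg₂ (· * ·) (hA.1.filter_causal u v t h) (hA.2.filter_causal u v t h)

lemma UsesNoise.filter_shift : ∀ {A : Multiplexed}, A.UsesNoise contractiveNoise →
    ∀ (τ : ℤ) (u : Input) (t : ℤ), A.filter (shift τ u) t = A.filter u (t + τ)
  | single _, hA, τ, u, t => Network.filter_shift hA τ u t
  | sum _ _, hA, τ, u, t =>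
    congrArg₂ (· + ·) (hA.1.filter_shift τ u t) (hA.2.filter_shift τ u t)
  | prod _ _, hA, τ, u, t =>
    congrArg₂ (· * ·) (hA.1.filter_shift τ u t) (hA.2.filter_shift τ u t)

lemma UsesNoise.continuous_filter : ∀ {A : Multiplexed}, A.UsesNoise contractiveNoise →
    Continuous fun u : Input => A.filter u 0
  | single _, hA => Network.continuous_filter hA
  | sum _ _, hA => hA.1.continuous_filter.add hA.2.continuous_filter
  | prod _ _, hA => hA.1.continuous_filter.mul hA.2.continuous_filter

end Multiplexed

/-! ### Fading memory and the product topology -/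

/-- The extension of a past input sequence to all times by `0`. -/
def extendPast (p : Set.Iic (0 : ℤ) → Set.Icc (0 : ℝ) 1) : Input :=
  fun t => if h : t ≤ 0 then p ⟨t, h⟩ else 0

lemma extendPast_of_nonpos (p : Set.Iic (0 : ℤ) → Set.Icc (0 : ℝ) 1) {t : ℤ} (ht : t ≤ 0) :
    extendPast p t = p ⟨t, ht⟩ := dif_pos ht

lemma continuous_extendPast : Continuous extendPast := by
  refine continuous_pi fun t => ?_
  unfold extendPast
  split_ifs
  · exact continuous_apply _
  · exact continuous_const

variable {ω : ℤ → ℝ}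

lemma abs_input_sub_le_one (u v : Input) (t : ℤ) : |(u t : ℝ) - v t| ≤ 1 :=
  abs_le.mpr ⟨by linarith [(u t).2.1, (v t).2.2], by linarith [(u t).2.2, (v t).2.1]⟩

lemma IsFadingWeight.le_fadingDist (hω : IsFadingWeight ω) (u v : Input) {t : ℤ} (ht : t ≤ 0) :
    |(u t : ℝ) - v t| * ω t ≤ fadingDist ω u v := by
  refine le_ciSup (f := fun t : Set.Iic (0 : ℤ) => |(u t : ℝ) - v t| * ω t) ?_ ⟨t, ht⟩
  refine ⟨1, ?_⟩
  rintro _ ⟨s, rfl⟩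
  exact mul_le_one₀ (abs_input_sub_le_one u v s) (hω.pos s s.2).le (hω.le_one s s.2)

/-- Since `|u t - v t| ≤ d_ω(u, v) / ω t`, convergence in `d_ω` forces convergence of every past
coordinate, and `H` sees only the past. -/
lemma IsFadingWeight.hasFadingMemory (hω : IsFadingWeight ω) {H : Input → ℝ} (hH : Continuous H)
    (hc : ∀ u v : Input, (∀ s, s ≤ 0 → u s = v s) → H u = H v) : HasFadingMemory ω H := by
  intro u ε hε
  let past : Input → Set.Iic (0 : ℤ) → Set.Icc (0 : ℝ) 1 := fun u t => u t
  have hpast : ∀ v, H (extendPast (past v)) = H v := fun v =>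
    hc _ _ fun s hs => extendPast_of_nonpos _ hs
  let l : Filter Input := Filter.comap (fun v => |fadingDist ω u v|) (nhds 0)
  have hl : Filter.Tendsto past l (nhds (past u)) := by
    rw [tendsto_pi_nhds]
    intro t
    rw [tendsto_subtype_rng, tendsto_iff_dist_tendsto_zero]
    have h0 : Filter.Tendsto (fun v => |fadingDist ω u v| / ω t) l (nhds 0) := by
      have := (Filter.tendsto_comap (f := fun v => |fadingDist ω u v|) (x := nhds 0)).div_const (ω t)
      rwa [zero_div] at this
    refine squeeze_zero (fun _ => dist_nonneg) (fun v => ?_) h0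
    rw [le_div_iff₀ (hω.pos t t.2), dist_comm, Real.dist_eq]
    exact (hω.le_fadingDist u v t.2).trans (le_abs_self _)
  have hlim := ((hH.comp continuous_extendPast).tendsto (past u)).comp hl
  have hev := hlim.eventually (Metric.ball_mem_nhds _ hε)
  rw [Filter.eventually_comap] at hev
  obtain ⟨δ, hδ, hball⟩ := Metric.eventually_nhds_iff.mp hev
  refine ⟨δ, hδ, fun v hv => ?_⟩
  have h0 : 0 ≤ fadingDist ω u v := Real.iSup_nonneg fun t =>
    mul_nonneg (abs_nonneg _) (hω.pos t t.2).le
  have := hball (y := |fadingDist ω u v|) (by simpa [abs_of_nonneg h0] using hv) v rfl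
  simpa [hpast, Real.dist_eq] using this

/-- Far in the past the weight alone makes the contribution to `d_ω` small; the finitely many
remaining coordinates are controlled by a product neighbourhood. -/
lemma HasFadingMemory.continuous (hω : IsFadingWeight ω) {H : Input → ℝ}
    (hH : HasFadingMemory ω H) : Continuous H := by
  rw [Metric.continuous_iff']
  intro u ε hε
  obtain ⟨δ, hδ, h⟩ := hH u ε hε
  obtain ⟨T, hT⟩ := Filter.eventually_atBot.mp
    (hω.tendsto_zero.eventually (Metric.ball_mem_nhds 0 (half_pos hδ)))
  have hev : ∀ᶠ v in nhds u, ∀ t ∈ Finset.Icc T 0, dist (v t) (u t) < δ / 2 := by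
    rw [Finset.eventually_all]
    intro t _
    exact (continuous_apply t).tendsto u (Metric.ball_mem_nhds _ (half_pos hδ))
  filter_upwards [hev] with v hv
  rw [Real.dist_eq]
  refine h v (lt_of_le_of_lt (b := δ / 2) (Real.iSup_le ?_ (half_pos hδ).le) (half_lt_self hδ))
  rintro ⟨t, ht⟩
  have ht' : t ≤ 0 := ht
  by_cases hTt : T ≤ t
  · have h1 := hv t (Finset.mem_Icc.mpr ⟨hTt, ht'⟩)
    rw [dist_comm, Subtype.dist_eq, Real.dist_eq] at h1
    exact (mul_le_of_le_one_right (abs_nonneg _) (hω.le_one t ht')).trans h1.le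
  · have h1 := hT t (by omega)
    rw [Real.dist_eq, sub_zero] at h1
    exact (mul_le_of_le_one_left (hω.pos t ht').le (abs_input_sub_le_one u v t)).trans
      ((le_abs_self _).trans h1.le)

lemma Multiplexed.UsesNoise.isFadingMemoryFilter (hω : IsFadingWeight ω) {A : Multiplexed}
    (hA : A.UsesNoise contractiveNoise) : IsFadingMemoryFilter ω A.filter where
  causal := hA.filter_causal
  time_invariant := hA.filter_shift
  fading := hω.hasFadingMemory hA.continuous_filter fun u v h => hA.filter_causal u v 0 h

/-! ### Networks on one qubit -/

section OneQubit

lemma midMeasure_univ {N : ℕ} (ρ : Op N) :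
    midMeasure Finset.univ ρ = Matrix.diagonal fun i => ρ i i := by
  ext i j
  rw [midMeasure, Matrix.sum_apply]
  simp only [outcomeProj, Matrix.diagonal_conjTranspose, Matrix.diagonal_mul,
    Matrix.mul_diagonal, Matrix.diagonal_apply]
  rw [Finset.sum_eq_single fun s : (Finset.univ : Finset (Fin N)) => i s]
  · by_cases h : i = j
    · simp [h]
    · have h' : ¬ ∀ s : Fin N, j s = i s := fun h' => h (funext fun s => (h' s).symm)
      simp [h, h']
  · intro m _ hm
    rw [if_neg fun h => hm (funext fun s => (h s).symm)]
    simp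
  · simp

lemma onQubit_add {N : ℕ} (s : Fin N) (A B : Matrix (Fin 2) (Fin 2) ℂ) :
    onQubit s (A + B) = onQubit s A + onQubit s B := by
  ext i j
  simp only [onQubit_apply, Matrix.add_apply]
  split_ifs <;> simp

lemma onQubit_smul {N : ℕ} (s : Fin N) (a : ℂ) (A : Matrix (Fin 2) (Fin 2) ℂ) :
    onQubit s (a • A) = a • onQubit s A := by
  ext i j
  simp only [onQubit_apply, Matrix.smul_apply]
  split_ifs <;> simp

/-- The Pauli matrix `X`. -/
def sigmaX : Matrix (Fin 2) (Fin 2) ℂ := !![0, 1; 1, 0]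

/-- The Pauli matrix `Y`. -/
def sigmaY : Matrix (Fin 2) (Fin 2) ℂ := !![0, -Complex.I; Complex.I, 0]

/-- The Pauli matrix `Z`. -/
def sigmaZ : Matrix (Fin 2) (Fin 2) ℂ := !![1, 0; 0, -1]

lemma exists_onQubit (A : Op 1) :
    A = onQubit 0 (Matrix.of fun a b => A (fun _ => a) (fun _ => b)) := by
  ext i j
  rw [onQubit_apply, if_pos fun k hk => absurd (Subsingleton.elim k 0) hk, Matrix.of_apply]
  congr 1 <;> exact funext fun k => by rw [Subsingleton.elim k 0]

lemma sum_qubit {β : Type*} [AddCommMonoid β] (f : (Fin 1 → Fin 2) → β) :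
    ∑ i, f i = f (fun _ => 0) + f (fun _ => 1) := by
  rw [← (Equiv.funUnique (Fin 1) (Fin 2)).symm.sum_comp f, Fin.sum_univ_two]
  rfl

lemma pauliZ_eq : (pauliZ 0 : Op 1) = onQubit 0 sigmaZ := by
  rw [exists_onQubit (pauliZ 0)]
  congr 1
  ext a b
  fin_cases a <;> fin_cases b <;> simp [pauliZ, sigmaZ, Matrix.diagonal_apply, funext_iff]

/-- The expectation of `Z` in the state `ρ`. -/
def zMean (ρ : Op 1) : ℝ := (pauliZ 0 * ρ).trace.re

lemma zMean_eq (ρ : Op 1) :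
    zMean ρ = (ρ (fun _ => 0) (fun _ => 0)).re - (ρ (fun _ => 1) (fun _ => 1)).re := by
  simp [zMean, pauliZ, Matrix.trace, sum_qubit, sub_eq_add_neg]

lemma zMean_add (ρ σ : Op 1) : zMean (ρ + σ) = zMean ρ + zMean σ := by
  simp [zMean_eq]; ring

lemma zMean_smul (a : ℝ) (ρ : Op 1) : zMean ((a : ℂ) • ρ) = a * zMean ρ := by
  simp [zMean_eq]; ring

lemma IsDensity.diag_entries {ρ : Op 1} (hρ : IsDensity ρ) :
    ρ (fun _ => 0) (fun _ => 0) = ((1 + zMean ρ) / 2 : ℝ) ∧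
      ρ (fun _ => 1) (fun _ => 1) = ((1 - zMean ρ) / 2 : ℝ) := by
  have h0 := Complex.le_def.mp (hρ.1.diag_nonneg (i := fun _ => 0))
  have h1 := Complex.le_def.mp (hρ.1.diag_nonneg (i := fun _ => 1))
  have htr := congrArg Complex.re hρ.2
  rw [Matrix.trace, sum_qubit, Complex.add_re, Complex.one_re] at htr
  simp only [Matrix.diag_apply] at htr
  rw [zMean_eq]
  refine ⟨Complex.ext ?_ ?_, Complex.ext ?_ ?_⟩
  · rw [Complex.ofReal_re]; linarith
  · rw [Complex.ofReal_im]; exact h0.2.symm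
  · rw [Complex.ofReal_re]; linarith
  · rw [Complex.ofReal_im]; exact h1.2.symm

lemma IsDensity.abs_zMean_le_one {ρ : Op 1} (hρ : IsDensity ρ) : |zMean ρ| ≤ 1 := by
  have h0 := (Complex.le_def.mp (hρ.1.diag_nonneg (i := fun _ => 0))).1
  have h1 := (Complex.le_def.mp (hρ.1.diag_nonneg (i := fun _ => 1))).1
  rw [hρ.diag_entries.1, Complex.ofReal_re, Complex.zero_re] at h0
  rw [hρ.diag_entries.2, Complex.ofReal_re, Complex.zero_re] at h1
  exact abs_le.mpr ⟨by linarith, by linarith⟩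

/-- The classical state with expectation `z` of `Z`. -/
def diagState (z : ℝ) : Op 1 := ((1 / 2 : ℝ) : ℂ) • (1 + (z : ℂ) • pauliZ 0)

lemma diagState_apply (z : ℝ) (i j : Fin 1 → Fin 2) :
    diagState z i j = if i = j then (if i 0 = 0 then ((1 + z) / 2 : ℝ) else ((1 - z) / 2 : ℝ))
      else 0 := by
  by_cases h : i = j
  · subst h
    by_cases h' : i 0 = 0
    · simp [diagState, pauliZ, h']; ring
    · simp [diagState, pauliZ, h']; ring
  · simp [diagState, pauliZ, h]

lemma zMean_diagState (z : ℝ) : zMean (diagState z) = z := by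
  rw [zMean_eq, diagState_apply, diagState_apply]
  simp
  ring

lemma midMeasure_univ_of_isDensity {ρ : Op 1} (hρ : IsDensity ρ) :
    midMeasure Finset.univ ρ = diagState (zMean ρ) := by
  rw [midMeasure_univ]
  ext i j
  rw [diagState_apply, Matrix.diagonal_apply]
  split_ifs with h h'
  · rw [← hρ.diag_entries.1]
    congr 1 <;> exact funext fun k => by rw [Subsingleton.elim k 0, h']
  · rw [← hρ.diag_entries.2]
    have h1 : i 0 = 1 := by omega
    congr 1 <;> exact funext fun k => by rw [Subsingleton.elim k 0, h1]
  · rfl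

variable {E : Op 1 →ₗ[ℂ] Op 1}

lemma conj_isDensity (C : Circuit 1) (x : ℝ) {ρ : Op 1} (hρ : IsDensity ρ) :
    IsDensity (circuitUnitary x C * ρ * (circuitUnitary x C).conjTranspose) := by
  rw [conj_eq_krausMap]
  exact hρ.krausMap (by simp [circuitUnitary_unitary])

lemma step_eq_diagState (hE : IsQuantumChannel E) (C : Circuit 1) (x : ℝ) {ρ : Op 1}
    (hρ : IsDensity ρ) : step C E Finset.univ x ρ =
      diagState (zMean (E (circuitUnitary x C * ρ * (circuitUnitary x C).conjTranspose))) :=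
  midMeasure_univ_of_isDensity (hE.isDensity (conj_isDensity C x hρ))

/-- Half the expectation of `Z` after the noise: for the operators `1, X, Y, Z` these are the
components of the affine map on the Bloch ball that are visible to the measurement. -/
def response (E : Op 1 →ₗ[ℂ] Op 1) (A : Op 1) : ℝ := zMean (E A) / 2

lemma response_add (A B : Op 1) : response E (A + B) = response E A + response E B := by
  simp only [response, map_add, zMean_add]; ring

lemma response_smul (a : ℝ) (A : Op 1) : response E ((a : ℂ) • A) = a * response E A := by
  simp only [response, map_smul, zMean_smul]; ring

/-- Conjugation by `U` fixes the identity part of the state, so the input acts only through the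
image of `Z`, with coefficient `z`. -/
lemma zMean_noise_conj_diagState (C : Circuit 1) (x z : ℝ) :
    zMean (E (circuitUnitary x C * diagState z * (circuitUnitary x C).conjTranspose)) =
      response E 1 + z *
        response E (circuitUnitary x C * pauliZ 0 * (circuitUnitary x C).conjTranspose) := by
  have hU : circuitUnitary x C * (circuitUnitary x C).conjTranspose = 1 :=
    mul_eq_one_comm.mp (circuitUnitary_unitary x C)
  have h : circuitUnitary x C * diagState z * (circuitUnitary x C).conjTranspose =
      ((1 / 2 : ℝ) : ℂ) • (1 + (z : ℂ) •
        (circuitUnitary x C * pauliZ 0 * (circuitUnitary x C).conjTranspose)) := by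
    simp only [diagState, Matrix.mul_smul, Matrix.smul_mul, Matrix.mul_add, Matrix.add_mul,
      Matrix.mul_one, hU]
  rw [← response_smul, ← response_add, response, h, map_smul, zMean_smul]
  ring

lemma diagState_zero : diagState 0 = ((1 / 2 : ℝ) : ℂ) • (1 : Op 1) := by
  simp [diagState]

lemma isDensity_diagState_zero : IsDensity (diagState 0) := by
  constructor
  · rw [diagState_zero]
    refine Matrix.PosSemidef.one.smul ?_
    rw [Complex.zero_le_real]
    norm_num
  · rw [diagState_zero, Matrix.trace_smul, Matrix.trace_one]
    simp

/-- Decomposition of a one-qubit state into Pauli matrices. -/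
lemma IsDensity.exists_bloch {ρ : Op 1} (hρ : IsDensity ρ) : ∃ a b c : ℝ,
    ρ = ((1 / 2 : ℝ) : ℂ) • (1 + (a : ℂ) • onQubit 0 sigmaX + (b : ℂ) • onQubit 0 sigmaY +
      (c : ℂ) • onQubit 0 sigmaZ) := by
  refine ⟨2 * (ρ (fun _ => 0) (fun _ => 1)).re, -2 * (ρ (fun _ => 0) (fun _ => 1)).im,
    zMean ρ, ?_⟩
  have h10 : ρ (fun _ => 1) (fun _ => 0) = star (ρ (fun _ => 0) (fun _ => 1)) :=
    (hρ.1.isHermitian.apply _ _).symm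
  rw [exists_onQubit ρ, ← onQubit_one 0]
  simp only [← onQubit_smul, ← onQubit_add]
  congr 1
  ext i j
  fin_cases i <;> fin_cases j
  · simp [sigmaX, sigmaY, sigmaZ, hρ.diag_entries.1, ← exists_onQubit]; ring
  · simp [sigmaX, sigmaY, sigmaZ, ← exists_onQubit]
    apply Complex.ext <;> simp
  · simp [sigmaX, sigmaY, sigmaZ, h10, ← exists_onQubit]
    apply Complex.ext <;> simp
  · simp [sigmaX, sigmaY, sigmaZ, hρ.diag_entries.2, ← exists_onQubit]; ring

/-- The measured qubit sees the noise's shift. -/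
lemma HasInputDependentFixedPoint.response_one_ne_zero (hE : IsQuantumChannel E)
    (h : HasInputDependentFixedPoint E) : response E 1 ≠ 0 := by
  obtain ⟨C, ρ, hinj, hρ⟩ := h
  intro h0
  -- Without a shift the maximally mixed state is fixed for every `x`, contradicting injectivity.
  have key : ∀ x, diagState 0 = ρ x := by
    intro x
    rw [← (hρ x).2 _ isDensity_diagState_zero, step_eq_diagState hE C x isDensity_diagState_zero,
      zMean_noise_conj_diagState, h0, zero_mul, add_zero]
  exact zero_ne_one (hinj ((key 0).symm.trans (key 1)))

/-- If all three responses vanished, `⟨Z⟩` after the noise would be the same for every state, and so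
would the fixed point for every input. -/
lemma HasInputDependentFixedPoint.response_pauli_ne_zero (hE : IsQuantumChannel E)
    (h : HasInputDependentFixedPoint E) : ¬ (response E (onQubit 0 sigmaX) = 0 ∧
      response E (onQubit 0 sigmaY) = 0 ∧ response E (onQubit 0 sigmaZ) = 0) := by
  obtain ⟨C, ρ, hinj, hρ⟩ := h
  rintro ⟨hX, hY, hZ⟩
  have hz : ∀ σ : Op 1, IsDensity σ → zMean (E σ) = response E 1 := by
    intro σ hσ
    obtain ⟨a, b, c, h⟩ := hσ.exists_bloch
    have h2 : zMean (E σ) = 2 * response E σ := by rw [response]; ring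
    rw [h2, h, response_smul, response_add, response_add, response_add, response_smul,
      response_smul, response_smul, hX, hY, hZ]
    ring
  have key : ∀ x, ρ x = diagState (response E 1) := by
    intro x
    have h1 := (hρ x).2 _ (hρ x).1 |>.mpr rfl
    rw [← h1, step_eq_diagState hE C x (hρ x).1, hz _ (conj_isDensity C x (hρ x).1)]
  exact zero_ne_one (hinj ((key 0).trans (key 1).symm))

lemma rotY_conj (θ : ℝ) : rotY θ * sigmaZ * (rotY θ).conjTranspose =
    (Real.cos θ : ℂ) • sigmaZ + (Real.sin θ : ℂ) • sigmaX := by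
  have h1 : Real.cos θ = Real.cos (θ / 2) ^ 2 - Real.sin (θ / 2) ^ 2 := by
    rw [← Real.cos_two_mul']; congr 1; ring
  have h2 : Real.sin θ = 2 * Real.sin (θ / 2) * Real.cos (θ / 2) := by
    rw [← Real.sin_two_mul]; congr 1; ring
  rw [h1, h2]
  ext i j
  fin_cases i <;> fin_cases j <;>
    simp [rotY, sigmaX, sigmaZ, Matrix.mul_apply, Fin.sum_univ_two, -Complex.ofReal_cos,
      -Complex.ofReal_sin] <;> ring

/-- The sign stays attached to `Y` so that the `RX` case has the same shape `cos θ * a + sin θ * b`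
as the `RY` case. -/
lemma rotX_conj (θ : ℝ) : rotX θ * sigmaZ * (rotX θ).conjTranspose =
    (Real.cos θ : ℂ) • sigmaZ + (Real.sin θ : ℂ) • ((-1 : ℝ) : ℂ) • sigmaY := by
  have h1 : Real.cos θ = Real.cos (θ / 2) ^ 2 - Real.sin (θ / 2) ^ 2 := by
    rw [← Real.cos_two_mul']; congr 1; ring
  have h2 : Real.sin θ = 2 * Real.sin (θ / 2) * Real.cos (θ / 2) := by
    rw [← Real.sin_two_mul]; congr 1; ring
  rw [h1, h2]
  ext i j
  fin_cases i <;> fin_cases j <;>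
    simp [rotX, sigmaY, sigmaZ, Matrix.mul_apply, Fin.sum_univ_two, -Complex.ofReal_cos,
      -Complex.ofReal_sin] <;> first
    | linear_combination (Real.sin (θ / 2) : ℂ) ^ 2 * Complex.I_sq
    | linear_combination -(Real.sin (θ / 2) : ℂ) ^ 2 * Complex.I_sq
    | ring

lemma exists_phase {a b : ℝ} (h : ¬ (a = 0 ∧ b = 0)) : ∃ θ₀ k : ℝ, k ≠ 0 ∧
    ∀ s, Real.cos (s + θ₀) * a + Real.sin (s + θ₀) * b = k * Real.sin s := by
  -- With `θ₀ = arg w` the `cos s` terms cancel, leaving the amplitude `-‖w‖`.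
  let w : ℂ := ⟨-b, a⟩
  have hw : w ≠ 0 := by
    intro hw
    exact h ⟨congrArg Complex.im hw, neg_eq_zero.mp (congrArg Complex.re hw)⟩
  have hn : ‖w‖ ≠ 0 := norm_ne_zero_iff.mpr hw
  have hsq : ‖w‖ ^ 2 = b * b + a * a := by
    rw [← Complex.normSq_eq_norm_sq, Complex.normSq_apply]
    simp [w]
  refine ⟨w.arg, -‖w‖, neg_ne_zero.mpr hn, fun s => ?_⟩
  rw [Real.cos_add, Real.sin_add, Complex.cos_arg hw, Complex.sin_arg]
  simp only [w] at hn hsq ⊢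
  field_simp
  rw [hsq]
  ring

/-- A channel with input-dependent fixed points admits a family of rotation gates, for which the
expectation of `Z` evolves by `z ↦ c + k sin (α x + β) z`. -/
lemma HasInputDependentFixedPoint.exists_gates (hE : IsQuantumChannel E)
    (h : HasInputDependentFixedPoint E) : ∃ (G : ℝ → ℝ → Gate 1) (c k : ℝ), c ≠ 0 ∧ k ≠ 0 ∧
      ∀ α β x z, zMean (E (circuitUnitary x [G α β] * diagState z *
        (circuitUnitary x [G α β]).conjTranspose)) = c + k * Real.sin (α * x + β) * z := by
  -- `RY` works when the noise responds in the `Z`–`X` plane. Otherwise it responds to `Y`, and `RX`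
  -- works. The phase `θ₀` is absorbed into the offset of the gate.
  by_cases hXZ : response E (onQubit 0 sigmaZ) = 0 ∧ response E (onQubit 0 sigmaX) = 0
  · have hYZ : ¬ (response E (onQubit 0 sigmaZ) = 0 ∧
        response E (((-1 : ℝ) : ℂ) • onQubit 0 sigmaY) = 0) := by
      rintro ⟨h1, h2⟩
      rw [response_smul] at h2
      exact h.response_pauli_ne_zero hE ⟨hXZ.2, by linarith, h1⟩
    obtain ⟨θ₀, k, hk, hθ⟩ := exists_phase hYZ
    refine ⟨fun α β => .rx 0 α (β + θ₀), response E 1, k, h.response_one_ne_zero hE, hk, ?_⟩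
    intro α β x z
    rw [zMean_noise_conj_diagState]
    simp only [circuitUnitary, Gate.matrix, Matrix.one_mul, pauliZ_eq, onQubit_conjTranspose,
      onQubit_mul, rotX_conj, onQubit_add, onQubit_smul, response_add]
    rw [response_smul, response_smul, ← add_assoc, hθ]
    ring
  · obtain ⟨θ₀, k, hk, hθ⟩ := exists_phase hXZ
    refine ⟨fun α β => .ry 0 α (β + θ₀), response E 1, k, h.response_one_ne_zero hE, hk, ?_⟩
    intro α β x z
    rw [zMean_noise_conj_diagState]
    simp only [circuitUnitary, Gate.matrix, Matrix.one_mul, pauliZ_eq, onQubit_conjTranspose,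
      onQubit_mul, rotY_conj, onQubit_add, onQubit_smul, response_add]
    rw [response_smul, response_smul, ← add_assoc, hθ]
    ring

/-- The network on one measured qubit with a single gate. -/
def qubitNetwork (E : Op 1 →ₗ[ℂ] Op 1) (g : Gate 1) (w : ℝ) : Network :=
  ⟨1, [g], E, Finset.univ, fun _ => w⟩

lemma qubitNetwork_filter {g : Gate 1} (w : ℝ) (hE : E ∈ contractiveNoise 1) {c : ℝ}
    {a : ℝ → ℝ} (hg : ∀ x z, zMean (E (circuitUnitary x [g] * diagState z *
        (circuitUnitary x [g]).conjTranspose)) = c + a x * z) (u : Input) :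
    ∃ z : ℤ → ℝ, (∀ t, |z t| ≤ 1) ∧ (∀ t, z (t + 1) = c + a (u (t + 1)) * z t) ∧
      ∀ t, (qubitNetwork E g w).filter u t = w * z t := by
  have hR : (qubitNetwork E g w).noise ∈ contractiveNoise (qubitNetwork E g w).qubits := hE
  obtain ⟨ρ, hρ⟩ : ∃ ρ : ℤ → Op 1, (qubitNetwork E g w).IsTrajectory u ρ :=
    Network.exists_isTrajectory hR.1 u
  have hstep : ∀ t, ρ (t + 1) = diagState (zMean (E (circuitUnitary (u (t + 1)) [g] * ρ t *
      (circuitUnitary (u (t + 1)) [g]).conjTranspose))) := fun t =>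
    (hρ.2 t).trans (step_eq_diagState hE.1 [g] _ (hρ.1 t))
  -- A trajectory has no initial time, so each of its states has just been measured.
  have hdiag : ∀ t, ρ t = diagState (zMean (ρ t)) := by
    intro t
    have h := hstep (t - 1)
    rw [sub_add_cancel] at h
    rw [h, zMean_diagState]
  refine ⟨fun t => zMean (ρ t), fun t => (hρ.1 t).abs_zMean_le_one, fun t => ?_, fun t => ?_⟩
  · simp only
    rw [hstep t, zMean_diagState, hdiag t, hg, zMean_diagState]
  · rw [Network.filter_eq hR hρ]
    simp only [Network.readout, qubitNetwork, Finset.univ_unique, Fin.default_eq_zero,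
      Finset.sum_singleton]
    rfl

end OneQubit

/-! ### Universality -/

/-- Two numbers are told apart, to first order in `δ`, by `sin (δ p)` and `sin (δ q)`. -/
lemma eq_of_sin_sub_sin_le {p q C : ℝ}
    (h : ∀ δ : ℝ, 0 < δ → δ ≤ 1 → |Real.sin (δ * p) - Real.sin (δ * q)| ≤ C * δ ^ 2) : p = q := by
  have hd : HasDerivAt (fun δ : ℝ => Real.sin (δ * p) - Real.sin (δ * q)) (p - q) 0 := by
    have h1 : ∀ r : ℝ, HasDerivAt (fun δ : ℝ => Real.sin (δ * r)) r 0 := fun r => by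
      simpa using ((hasDerivAt_id (0 : ℝ)).mul_const r).sin
    exact (h1 p).sub (h1 q)
  have h1 := (hasDerivAt_iff_tendsto_slope.mp hd).mono_left
    (nhdsWithin_mono 0 (s := Set.Ioi 0) fun x hx => ne_of_gt hx)
  have h2 : Filter.Tendsto (fun δ : ℝ => C * δ) (nhdsWithin 0 (Set.Ioi 0)) (nhds 0) := by
    have : Filter.Tendsto (fun δ : ℝ => C * δ) (nhds 0) (nhds (C * 0)) :=
      (continuous_const.mul continuous_id).tendsto 0
    rw [mul_zero] at this
    exact this.mono_left nhdsWithin_le_nhds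
  have h3 : |p - q| ≤ 0 := by
    refine le_of_tendsto_of_tendsto h1.abs h2 ?_
    filter_upwards [Ioc_mem_nhdsGT (zero_lt_one (α := ℝ))] with δ hδ
    have := h δ hδ.1 hδ.2
    rw [slope_def_field, sub_zero]
    simp only [zero_mul, Real.sin_zero, sub_zero]
    rw [abs_div, abs_of_pos hδ.1, div_le_iff₀ hδ.1]
    linarith
  exact sub_eq_zero.mp (abs_nonpos_iff.mp h3)

/-- The offset `δ` keeps the angle in `(0, 2]`, inside `(0, π)`, so the recursion is invertible even
for input `0`. -/
lemma sin_pos_of_unit {δ x : ℝ} (h0 : 0 < δ) (h1 : δ ≤ 1) (hx : x ∈ Set.Icc (0 : ℝ) 1) :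
    0 < Real.sin (δ * x + δ) := by
  have h2 := mul_le_mul h1 hx.2 hx.1 zero_le_one
  have h3 := mul_nonneg h0.le hx.1
  exact Real.sin_pos_of_pos_of_lt_pi (by linarith) (by linarith [Real.pi_gt_three])

lemma sin_le_of_unit {δ x : ℝ} (h0 : 0 < δ) (hx : x ∈ Set.Icc (0 : ℝ) 1) :
    Real.sin (δ * x + δ) ≤ 2 * δ := by
  have h3 := mul_nonneg h0.le hx.1
  have h4 := mul_le_mul_of_nonneg_left hx.2 h0.le
  exact (Real.sin_le (by linarith)).trans (by linarith)

/-- Different pasts are distinguished by the recursions `z ↦ c + k sin (δ x + δ) z`. -/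
lemma exists_separating {c k : ℝ} (hc : c ≠ 0) (hk : k ≠ 0) {u v : Input} {s : ℤ} (hs : s ≤ 0)
    (huv : u s ≠ v s) {z w : ℝ → ℤ → ℝ} (hz : ∀ δ t, |z δ t| ≤ 1) (hw : ∀ δ t, |w δ t| ≤ 1)
    (hzr : ∀ δ t, z δ (t + 1) = c + k * Real.sin (δ * u (t + 1) + δ) * z δ t)
    (hwr : ∀ δ t, w δ (t + 1) = c + k * Real.sin (δ * v (t + 1) + δ) * w δ t) :
    ∃ δ, z δ 0 ≠ w δ 0 := by
  -- `-n` is the latest nonpositive time at which the inputs differ.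
  obtain ⟨n, hn, hmin⟩ : ∃ n : ℕ, u (-n) ≠ v (-n) ∧ ∀ m < n, u (-(m : ℤ)) = v (-(m : ℤ)) := by
    classical
    have hex : ∃ n : ℕ, u (-(n : ℤ)) ≠ v (-(n : ℤ)) := by
      refine ⟨s.natAbs, ?_⟩
      rwa [show -(s.natAbs : ℤ) = s by omega]
    exact ⟨Nat.find hex, Nat.find_spec hex, fun m hm => not_not.mp (Nat.find_min hex hm)⟩
  by_contra! hcon
  -- After time `-n` both recursions have the same nonzero coefficients, so equality at time `0`
  -- propagates back to `-n`.
  have hback : ∀ δ : ℝ, 0 < δ → δ ≤ 1 → ∀ m : ℕ, m ≤ n → z δ (-(m : ℤ)) = w δ (-(m : ℤ)) := by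
    intro δ h0 h1 m
    induction m with
    | zero => intro _; simpa using hcon δ
    | succ m ih =>
      intro hm
      have e1 := hzr δ (-((m + 1 : ℕ) : ℤ))
      have e2 := hwr δ (-((m + 1 : ℕ) : ℤ))
      rw [show -((m + 1 : ℕ) : ℤ) + 1 = -(m : ℤ) by push_cast; ring] at e1 e2
      rw [← hmin m (by omega), ← ih (by omega), e1] at e2
      exact mul_left_cancel₀ (mul_ne_zero hk (sin_pos_of_unit h0 h1 (u _).2).ne')
        (add_left_cancel e2)
  refine hn (Subtype.ext (add_right_cancel (b := (1 : ℝ)) (eq_of_sin_sub_sin_le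
    (C := 8 * |k| / |c|) fun δ h0 h1 => ?_)))
  have e := hback δ h0 h1 n le_rfl
  -- Two steps of the recursion isolate the input at `-n`: each sine is at most `2 * δ`, so
  -- everything older enters at order `δ ^ 2`.
  have unroll : ∀ (x : Input) (y : ℝ → ℤ → ℝ), (∀ δ t, |y δ t| ≤ 1) →
      (∀ δ t, y δ (t + 1) = c + k * Real.sin (δ * x (t + 1) + δ) * y δ t) →
      ∃ r : ℝ, |r| ≤ 4 * |k| ^ 2 * δ ^ 2 ∧
        y δ (-n) = c + c * k * Real.sin (δ * ((x (-n) : ℝ) + 1)) + r := by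
    intro x y hy hyr
    have e1 := hyr δ (-n - 1)
    have e2 := hyr δ (-n - 1 - 1)
    rw [sub_add_cancel] at e1 e2
    refine ⟨k * Real.sin (δ * x (-n) + δ) * (k * Real.sin (δ * x (-n - 1) + δ) *
      y δ (-n - 1 - 1)), ?_, ?_⟩
    · have a1 := sin_pos_of_unit h0 h1 (x (-n)).2
      have a2 := sin_pos_of_unit h0 h1 (x (-n - 1)).2
      have b1 := sin_le_of_unit h0 (x (-n)).2
      have b2 := sin_le_of_unit h0 (x (-n - 1)).2
      have b3 := hy δ (-n - 1 - 1)
      simp only [abs_mul, abs_of_pos a1, abs_of_pos a2]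
      calc |k| * Real.sin (δ * x (-n) + δ) * (|k| * Real.sin (δ * x (-n - 1) + δ) *
            |y δ (-n - 1 - 1)|) ≤ |k| * (2 * δ) * (|k| * (2 * δ) * 1) := by gcongr
        _ = 4 * |k| ^ 2 * δ ^ 2 := by ring
    · rw [e1, e2]; ring_nf
  obtain ⟨r₁, hr₁, e₁⟩ := unroll u z hz hzr
  obtain ⟨r₂, hr₂, e₂⟩ := unroll v w hw hwr
  have hdiff : c * k * (Real.sin (δ * ((u (-n) : ℝ) + 1)) - Real.sin (δ * ((v (-n) : ℝ) + 1))) =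
      r₂ - r₁ := by linarith
  have habs := congrArg abs hdiff
  rw [abs_mul, abs_mul] at habs
  have hle : |r₂ - r₁| ≤ 8 * |k| ^ 2 * δ ^ 2 := (abs_sub _ _).trans (by linarith)
  rw [← habs] at hle
  have hc' := abs_pos.mpr hc
  have hk' := abs_pos.mpr hk
  rw [div_mul_eq_mul_div, le_div_iff₀ hc']
  refine le_of_mul_le_mul_left (a := |k|) ?_ hk'
  linarith

/-- The functionals on pasts that are computed by multiplexed networks with noise in `𝒩`. -/
def networkAlgebra (𝒩 : ∀ N : ℕ, Set (Op N →ₗ[ℂ] Op N)) (hconst : ∀ r : ℝ, ∃ A : Multiplexed,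
    A.UsesNoise 𝒩 ∧ ∀ u t, A.filter u t = r) :
    Subalgebra ℝ C(Set.Iic (0 : ℤ) → Set.Icc (0 : ℝ) 1, ℝ) where
  carrier := {f | ∃ A : Multiplexed, A.UsesNoise 𝒩 ∧ ∀ p, f p = A.filter (extendPast p) 0}
  mul_mem' := by
    rintro f g ⟨A, hA, hf⟩ ⟨B, hB, hg⟩
    exact ⟨.prod A B, ⟨hA, hB⟩, fun p => congrArg₂ (· * ·) (hf p) (hg p)⟩
  add_mem' := by
    rintro f g ⟨A, hA, hf⟩ ⟨B, hB, hg⟩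
    exact ⟨.sum A B, ⟨hA, hB⟩, fun p => congrArg₂ (· + ·) (hf p) (hg p)⟩
  algebraMap_mem' := by
    intro r
    obtain ⟨A, hA, h⟩ := hconst r
    exact ⟨A, hA, fun p => (h _ 0).symm⟩

/-- Stone–Weierstrass approximates `F` at time `0` uniformly over all pasts; causality and time
invariance carry the same bound to every time. -/
lemma isUniversal_of_separating {ω : ℤ → ℝ} (hω : IsFadingWeight ω)
    {𝒩 : ∀ N : ℕ, Set (Op N →ₗ[ℂ] Op N)} (h𝒩 : ∀ N, 𝒩 N ⊆ contractiveNoise N)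
    (hconst : ∀ r : ℝ, ∃ A : Multiplexed, A.UsesNoise 𝒩 ∧ ∀ u t, A.filter u t = r)
    (hsep : ∀ u v : Input, ∀ s ≤ 0, u s ≠ v s → ∃ A : Multiplexed, A.UsesNoise 𝒩 ∧
      A.filter u 0 ≠ A.filter v 0) : IsUniversal ω 𝒩 := by
  intro F hF ε hε
  let Fc : C(Set.Iic (0 : ℤ) → Set.Icc (0 : ℝ) 1, ℝ) :=
    ⟨fun p => F (extendPast p) 0, (hF.fading.continuous hω).comp continuous_extendPast⟩
  have hpoints : (networkAlgebra 𝒩 hconst).SeparatesPoints := by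
    intro p q hpq
    obtain ⟨s, hs⟩ := Function.ne_iff.mp hpq
    have hs0 : (s : ℤ) ≤ 0 := s.2
    obtain ⟨A, hA, hne⟩ := hsep (extendPast p) (extendPast q) s hs0 (by
      rwa [extendPast_of_nonpos _ hs0, extendPast_of_nonpos _ hs0])
    let f : C(Set.Iic (0 : ℤ) → Set.Icc (0 : ℝ) 1, ℝ) := ⟨fun p => A.filter (extendPast p) 0,
      (hA.mono h𝒩).continuous_filter.comp continuous_extendPast⟩
    have hf : f ∈ networkAlgebra 𝒩 hconst := ⟨A, hA, fun _ => rfl⟩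
    exact ⟨f, Set.mem_image_of_mem _ hf, hne⟩
  obtain ⟨g, hg⟩ := ContinuousMap.exists_mem_subalgebra_near_continuousMap_of_separatesPoints
    (networkAlgebra 𝒩 hconst) hpoints Fc ε hε
  obtain ⟨A, hA, hf⟩ := g.2
  have hA' := hA.mono h𝒩
  refine ⟨A, hA, hA'.echoState, fun u t => ?_⟩
  let p : Set.Iic (0 : ℤ) → Set.Icc (0 : ℝ) 1 := fun s => shift t u s
  have hp : ∀ s ≤ 0, shift t u s = extendPast p s := fun s hs => (extendPast_of_nonpos p hs).symm
  have h1 : A.filter u t = (g : C(Set.Iic (0 : ℤ) → Set.Icc (0 : ℝ) 1, ℝ)) p := by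
    rw [hf, ← hA'.filter_causal _ _ 0 hp, hA'.filter_shift, zero_add]
  have h2 : F u t = Fc p := by
    change F u t = F (extendPast p) 0
    rw [← hF.causal _ _ 0 hp, hF.time_invariant, zero_add]
  rw [h1, h2]
  exact ((g - Fc : C(Set.Iic (0 : ℤ) → Set.Icc (0 : ℝ) 1, ℝ)).norm_coe_le_norm p).trans_lt hg

lemma isUniversal_of_inputDependentFixedPoint {ω : ℤ → ℝ} (hω : IsFadingWeight ω)
    {𝒩 : ∀ N : ℕ, Set (Op N →ₗ[ℂ] Op N)} (h𝒩 : ∀ N, 𝒩 N ⊆ contractiveNoise N)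
    {E : Op 1 →ₗ[ℂ] Op 1} (hE𝒩 : E ∈ 𝒩 1) (hE : HasInputDependentFixedPoint E) :
    IsUniversal ω 𝒩 := by
  have hEc := h𝒩 1 hE𝒩
  obtain ⟨G, c, k, hc, hk, hG⟩ := hE.exists_gates hEc.1
  refine isUniversal_of_separating hω h𝒩 (fun r => ?_) fun u v s hs huv => ?_
  -- At zero angle the sine vanishes, so `z` is constantly `c`.
  · refine ⟨.single (qubitNetwork E (G 0 0) (r / c)), hE𝒩, fun u t => ?_⟩
    obtain ⟨z, -, hz, hf⟩ := qubitNetwork_filter (r / c) hEc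
      (a := fun x => k * Real.sin (0 * x + 0)) (hG 0 0) u
    have h1 := hz (t - 1)
    rw [sub_add_cancel] at h1
    refine (hf t).trans ?_
    rw [h1]
    simp [hc]
  · have key := fun (δ : ℝ) (u : Input) => qubitNetwork_filter 1 hEc
      (a := fun x => k * Real.sin (δ * x + δ)) (hG δ δ) u
    choose z hz hzr hf using key
    obtain ⟨δ, hδ⟩ := exists_separating hc hk hs huv (fun δ => hz δ u) (fun δ => hz δ v)
      (fun δ => hzr δ u) (fun δ => hzr δ v)
    refine ⟨.single (qubitNetwork E (G δ δ) 1), hE𝒩, ?_⟩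
    intro h
    refine hδ ?_
    have h' : 1 * z δ u 0 = 1 * z δ v 0 := by
      rw [← hf, ← hf]
      exact h
    simpa using h'

/-! ### Amplitude damping -/

section Damping

variable {N : ℕ} {γ : ℝ}

/-- The Kraus operators of amplitude damping on `N` qubits. -/
def dampingKraus (γ : ℝ) (a : Fin N → Fin 2) : Op N :=
  Matrix.of fun i j => ∏ s, adKraus γ (a s) (i s) (j s)

lemma amplitudeDamping_eq (γ : ℝ) (N : ℕ) : amplitudeDamping γ N = krausMap (dampingKraus γ) := rfl

lemma dampingKraus_apply (a i j : Fin N → Fin 2) :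
    dampingKraus γ a i j = ∏ s, adKraus γ (a s) (i s) (j s) := rfl

/-- Reduces identities for tensor-product Kraus operators to one qubit at a time. -/
lemma sum_sum_prod_eq (f : Fin N → Fin 2 → Fin 2 → ℂ) :
    ∑ a : Fin N → Fin 2, ∑ k : Fin N → Fin 2, ∏ s, f s (a s) (k s) = ∏ s, ∑ b, ∑ l, f s b l := by
  simp only [Finset.prod_univ_sum, Fintype.piFinset_univ]

lemma ofReal_sqrt_mul_self {x : ℝ} (hx : 0 ≤ x) :
    ((Real.sqrt x : ℝ) : ℂ) * (Real.sqrt x : ℝ) = x := by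
  rw [← Complex.ofReal_mul, Real.mul_self_sqrt hx]

lemma dampingKraus_complete (h0 : 0 < γ) (h1 : γ < 1) :
    ∑ a : Fin N → Fin 2, (dampingKraus γ a).conjTranspose * dampingKraus γ a = 1 := by
  have hs := ofReal_sqrt_mul_self h0.le
  have hs' := ofReal_sqrt_mul_self (sub_pos.mpr h1).le
  push_cast at hs'
  ext i j
  simp only [Matrix.sum_apply, Matrix.mul_apply, Matrix.conjTranspose_apply, dampingKraus_apply,
    star_prod, ← Finset.prod_mul_distrib]
  rw [sum_sum_prod_eq fun s b l => star (adKraus γ b l (i s)) * adKraus γ b l (j s)]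
  have key : ∀ p q : Fin 2, ∑ b, ∑ l, star (adKraus γ b l p) * adKraus γ b l q =
      if p = q then 1 else 0 := by
    intro p q
    fin_cases p <;> fin_cases q <;> simp [adKraus, Fin.sum_univ_two, hs, hs']
  simp only [key]
  by_cases h : i = j
  · subst h; simp
  · obtain ⟨s, hs⟩ := Function.ne_iff.mp h
    rw [Matrix.one_apply_ne h]
    exact Finset.prod_eq_zero (Finset.mem_univ s) (if_neg hs)

lemma amplitudeDamping_isQuantumChannel (h0 : 0 < γ) (h1 : γ < 1) :
    IsQuantumChannel (amplitudeDamping γ N) := by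
  let e := Fintype.equivFin (Fin N → Fin 2)
  refine ⟨_, fun a => dampingKraus γ (e.symm a), ?_, ?_⟩
  · rw [← dampingKraus_complete (N := N) h0 h1]
    exact e.symm.sum_comp fun a => (dampingKraus γ a).conjTranspose * dampingKraus γ a
  · ext1 A
    rw [amplitudeDamping_eq, krausMap_apply, krausMap_apply]
    exact (e.symm.sum_comp fun a => dampingKraus γ a * A * (dampingKraus γ a).conjTranspose).symm

/-- The ground-state entry of the image of the identity is `(1 + γ) ^ N`, which exceeds `1`. -/
lemma amplitudeDamping_not_isUnital (h0 : 0 < γ) (hN : 0 < N) :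
    ¬ IsUnital (amplitudeDamping γ N) := by
  intro h
  have hs := ofReal_sqrt_mul_self h0.le
  have h00 := congrFun (congrFun h 0) 0
  rw [amplitudeDamping_eq, krausMap_apply, Matrix.sum_apply, Matrix.one_apply_eq] at h00
  simp only [Matrix.mul_one, Matrix.mul_apply, Matrix.conjTranspose_apply, dampingKraus_apply,
    star_prod, ← Finset.prod_mul_distrib] at h00
  rw [sum_sum_prod_eq fun s b l => adKraus γ b ((0 : Fin N → Fin 2) s) l *
    star (adKraus γ b ((0 : Fin N → Fin 2) s) l)] at h00
  simp only [Pi.zero_apply, Fin.sum_univ_two, Finset.prod_const, Finset.card_univ,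
    Fintype.card_fin] at h00
  have hval : adKraus γ 0 0 0 * star (adKraus γ 0 0 0) + adKraus γ 0 0 1 * star (adKraus γ 0 0 1) +
      (adKraus γ 1 0 0 * star (adKraus γ 1 0 0) + adKraus γ 1 0 1 * star (adKraus γ 1 0 1)) =
      ((1 + γ : ℝ) : ℂ) := by
    simp [adKraus, hs]
  rw [hval, ← Complex.ofReal_pow, Complex.ofReal_eq_one] at h00
  exact (one_lt_pow₀ (by linarith : 1 < 1 + γ) hN.ne').ne' h00

/-- Every vector is sent to a non-zero multiple of the ground state by some Kraus operator: the one
that damps exactly the excitations of a maximal basis state in the support. -/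
lemma exists_dampingKraus_mulVec (h0 : 0 < γ) {v : (Fin N → Fin 2) → ℂ} (hv : v ≠ 0) :
    ∃ (a : Fin N → Fin 2) (c : ℂ), c ≠ 0 ∧ (dampingKraus γ a).mulVec v = c • Pi.single 0 1 := by
  obtain ⟨i₀, hi₀⟩ := Function.ne_iff.mp hv
  obtain ⟨i, hi⟩ := Set.Finite.exists_maximal (Set.toFinite {i | v i ≠ 0}) ⟨i₀, hi₀⟩
  have hK1 : ∀ p q : Fin 2, adKraus γ 1 p q ≠ 0 → p = 0 ∧ q = 1 := by
    intro p q
    fin_cases p <;> fin_cases q <;> simp [adKraus]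
  have hK0 : ∀ p q : Fin 2, adKraus γ 0 p q ≠ 0 → q = p := by
    intro p q
    fin_cases p <;> fin_cases q <;> simp [adKraus]
  -- The operator labelled `i` needs an excitation wherever `i` has one, so `i ≤ k`; maximality of
  -- `i` in the support leaves only `k = i`, with all its excitations removed.
  have hterm : ∀ j k, dampingKraus γ i j k * v k ≠ 0 → k = i ∧ j = 0 := by
    intro j k h
    have hprod := left_ne_zero_of_mul h
    rw [dampingKraus_apply, Finset.prod_ne_zero_iff] at hprod
    have hle : i ≤ k := by
      intro s
      have h2 := hprod s (Finset.mem_univ s)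
      by_cases h3 : i s = 0
      · rw [h3]; exact Fin.zero_le _
      · have h4 : i s = 1 := by omega
        rw [h4] at h2 ⊢
        rw [(hK1 _ _ h2).2]
    have hki : k = i := le_antisymm (hi.2 (right_ne_zero_of_mul h) hle) hle
    refine ⟨hki, funext fun s => ?_⟩
    have h2 := hprod s (Finset.mem_univ s)
    by_cases h3 : i s = 0
    · rw [h3] at h2
      rw [← hK0 _ _ h2, hki, h3]
      rfl
    · have h4 : i s = 1 := by omega
      rw [h4] at h2
      exact (hK1 _ _ h2).1
  refine ⟨i, dampingKraus γ i 0 i * v i, mul_ne_zero ?_ hi.1, ?_⟩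
  · rw [dampingKraus_apply, Finset.prod_ne_zero_iff]
    intro s _
    by_cases h3 : i s = 0
    · simp [h3, adKraus]
    · have h4 : i s = 1 := by omega
      simp [h4, adKraus, (Real.sqrt_pos.mpr h0).ne']
  · ext j
    rw [Matrix.mulVec, dotProduct]
    by_cases hj : j = 0
    · subst hj
      rw [Finset.sum_eq_single i]
      · simp
      · intro k _ hk
        by_contra h
        exact hk (hterm _ _ h).1
      · simp
    · rw [Finset.sum_eq_zero]
      · simp [hj]
      · intro k _
        by_contra h
        exact hj (hterm _ _ h).2

/-- Write `P = B * B†`. The trace is a sum of nonnegative terms over Kraus operators, so each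
vanishes. One of them sends a nonzero column of `B` to a multiple of the ground vector, on which the
form of `T` must then vanish. -/
lemma mulVec_ground_eq_zero (h0 : 0 < γ) {P T : Op N} (hP : P.PosSemidef) (hP0 : P ≠ 0)
    (hT : T.PosSemidef) (h : (amplitudeDamping γ N P * T).trace.re = 0) :
    T.mulVec (Pi.single 0 1) = 0 := by
  obtain ⟨C, hC⟩ : ∃ C : Op N, P = C.conjTranspose * C :=
    CStarAlgebra.nonneg_iff_eq_star_mul_self.mp (Matrix.nonneg_iff_posSemidef.mpr hP)
  set B := C.conjTranspose with hB
  have hPB : P = B * B.conjTranspose := by rw [hC, hB, Matrix.conjTranspose_conjTranspose]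
  obtain ⟨k, hk⟩ : ∃ k, B.col k ≠ 0 := by
    by_contra! hcon
    refine hP0 ?_
    have : B = 0 := by
      ext i j
      exact congrFun (hcon j) i
    rw [hPB, this, Matrix.zero_mul]
  obtain ⟨a, c, hc, ha⟩ := exists_dampingKraus_mulVec h0 hk
  have hpsd : ∀ a, ((dampingKraus γ a * B).conjTranspose * T * (dampingKraus γ a * B)).PosSemidef :=
    fun a => hT.conjTranspose_mul_mul_same _
  have hsum : ∑ a, ((dampingKraus γ a * B).conjTranspose * T * (dampingKraus γ a * B)).trace.re =
      0 := by
    rw [← h, amplitudeDamping_eq, krausMap_apply, Finset.sum_mul, Matrix.trace_sum, Complex.re_sum]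
    refine Finset.sum_congr rfl fun a _ => ?_
    rw [Matrix.trace_mul_comm, hPB, Matrix.conjTranspose_mul]
    simp only [Matrix.mul_assoc]
  have hzero := PosSemidef.eq_zero_of_re_trace (hpsd a)
    ((Finset.sum_eq_zero_iff_of_nonneg fun a _ => re_trace_nonneg (hpsd a)).mp hsum a
      (Finset.mem_univ a))
  have hcol : (dampingKraus γ a * B).mulVec (Pi.single k 1) = c • Pi.single 0 1 := by
    rw [← Matrix.mulVec_mulVec, Matrix.mulVec_single_one, ha]
  have hquad : star ((dampingKraus γ a * B).mulVec (Pi.single k 1)) ⬝ᵥ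
      T.mulVec ((dampingKraus γ a * B).mulVec (Pi.single k 1)) = 0 := by
    rw [Matrix.star_mulVec, ← Matrix.dotProduct_mulVec, Matrix.mulVec_mulVec,
      Matrix.mulVec_mulVec, hzero, Matrix.zero_mulVec, dotProduct_zero]
  rw [hT.dotProduct_mulVec_zero_iff, hcol, Matrix.mulVec_smul] at hquad
  exact (smul_eq_zero.mp hquad).resolve_left hc

/-! ### Strict contractivity of amplitude damping -/

lemma IsHermitianContraction.norm_apply_le {S : Op N} (hS : IsHermitianContraction S)
    (i j : Fin N → Fin 2) : ‖S i j‖ ≤ (Matrix.trace (1 : Op N)).re := by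
  have h1 := norm_apply_le_re_trace hS.1 i j
  have h2 := norm_apply_le_re_trace hS.2 i j
  rw [Matrix.trace_sub, Complex.sub_re] at h1
  rw [Matrix.trace_add, Complex.add_re] at h2
  have h3 : S i j = ((1 + S) i j - (1 - S) i j) / 2 := by
    rw [Matrix.add_apply, Matrix.sub_apply]; ring
  rw [h3, norm_div, Complex.norm_ofNat, div_le_iff₀ two_pos]
  exact (norm_sub_le _ _).trans (by linarith)

lemma isCompact_isHermitianContraction : IsCompact {S : Op N | IsHermitianContraction S} := by
  have hK : IsCompact (Set.univ.pi fun _ : Fin N → Fin 2 => Set.univ.pi fun _ : Fin N → Fin 2 =>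
      Metric.closedBall (0 : ℂ) (Matrix.trace (1 : Op N)).re) :=
    isCompact_univ_pi fun _ => isCompact_univ_pi fun _ => isCompact_closedBall 0 _
  refine hK.of_isClosed_subset ?_ ?_
  · have h1 : Continuous fun S : Op N => 1 - S := by fun_prop
    have h2 : Continuous fun S : Op N => 1 + S := by fun_prop
    exact (isClosed_posSemidef.preimage h1).inter (isClosed_posSemidef.preimage h2)
  · intro S hS i _ j _
    exact mem_closedBall_zero_iff.mpr (IsHermitianContraction.norm_apply_le hS i j)

lemma IsDensity.ne_zero {ρ : Op N} (hρ : IsDensity ρ) : ρ ≠ 0 := by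
  rintro rfl
  simpa using hρ.2

/-- The value `2` would force both `1 - S` and `1 + S` to annihilate the ground vector, although
they add up to `2`. -/
lemma IsDensity.re_trace_damping_lt_two (h0 : 0 < γ) (h1 : γ < 1) {P Q S : Op N}
    (hP : IsDensity P) (hQ : IsDensity Q) (hS : IsHermitianContraction S) :
    ((amplitudeDamping γ N P - amplitudeDamping γ N Q) * S).trace.re < 2 := by
  have hE := amplitudeDamping_isQuantumChannel (N := N) h0 h1
  have hEP := hE.isDensity hP
  have hEQ := hE.isDensity hQ
  have a1 := re_trace_mul_nonneg hEP.1 hS.1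
  have a2 := re_trace_mul_nonneg hEQ.1 hS.2
  by_contra! hcon
  have hz1 := mulVec_ground_eq_zero h0 hP.1 hP.ne_zero hS.1
  have hz2 := mulVec_ground_eq_zero h0 hQ.1 hQ.ne_zero hS.2
  simp only [Matrix.mul_sub, Matrix.mul_add, Matrix.sub_mul, Matrix.mul_one, Matrix.trace_sub,
    Matrix.trace_add, Complex.sub_re, Complex.add_re, hEP.2, hEQ.2, Complex.one_re]
    at a1 a2 hcon hz1 hz2
  have h3 := congrArg₂ (· + ·) (hz1 (by linarith)) (hz2 (by linarith))
  simp only [← Matrix.add_mulVec, sub_add_add_cancel, add_zero] at h3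
  have h4 := congrFun h3 0
  rw [Matrix.add_mulVec, Matrix.one_mulVec] at h4
  norm_num at h4

lemma amplitudeDamping_isStrictlyContractive (h0 : 0 < γ) (h1 : γ < 1) :
    IsStrictlyContractive (amplitudeDamping γ N) := by
  have hE := amplitudeDamping_isQuantumChannel (N := N) h0 h1
  have hcpt := (isCompact_isDensity (N := N)).prod
    ((isCompact_isDensity (N := N)).prod (isCompact_isHermitianContraction (N := N)))
  obtain ⟨ρ₀, hρ₀⟩ := exists_isDensity N
  have hcont : Continuous fun p : Op N × Op N × Op N =>
      ((amplitudeDamping γ N p.1 - amplitudeDamping γ N p.2.1) * p.2.2).trace.re := by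
    have e1 := hE.continuous.comp (continuous_fst (X := Op N) (Y := Op N × Op N))
    have e2 := hE.continuous.comp (continuous_fst.comp
      (continuous_snd (X := Op N) (Y := Op N × Op N)))
    have e3 := continuous_snd.comp (continuous_snd (X := Op N) (Y := Op N × Op N))
    exact Complex.continuous_re.comp ((e1.sub e2).mul e3).matrix_trace
  obtain ⟨⟨P₀, Q₀, S₀⟩, hm, hmax⟩ := hcpt.exists_isMaxOn
    ⟨(ρ₀, ρ₀, 0), hρ₀, hρ₀, by simpa using Matrix.PosSemidef.one,
      by simpa using Matrix.PosSemidef.one⟩ hcont.continuousOn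
  -- Half the maximal pairing is the contraction factor; being attained, it is strictly below `1`.
  refine ⟨((amplitudeDamping γ N P₀ - amplitudeDamping γ N Q₀) * S₀).trace.re / 2, ?_, ?_⟩
  · rw [div_lt_one two_pos]
    exact IsDensity.re_trace_damping_lt_two h0 h1 hm.1 hm.2.1 hm.2.2
  · intro ρ σ hρ hσ
    obtain ⟨P, Q, hP, hQ, h, htr⟩ := exists_jordan (hρ.sub_isHermitian hσ)
    obtain ⟨S, hS, hES⟩ := exists_sign
      ((hE.isDensity hρ).sub_isHermitian (hE.isDensity hσ))
    have htrace : P.trace = Q.trace := by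
      rw [← sub_eq_zero, ← Matrix.trace_sub, ← h, Matrix.trace_sub, hρ.2, hσ.2, sub_self]
    have him : (P.trace.re : ℂ) = P.trace :=
      Complex.ext rfl (Complex.le_def.mp hP.trace_nonneg).2
    rw [← map_sub, h, map_sub] at hES
    rw [← map_sub, h, map_sub, hES, ← h, htr, ← htrace]
    -- The Jordan parts of `ρ - σ` have equal trace `τ`, half its trace norm. If `τ > 0` they are
    -- rescaled to density operators, to which the maximum applies.
    rcases (re_trace_nonneg hP).eq_or_lt with hτ | hτ
    · have hQτ : Q.trace.re = 0 := by rw [← htrace, ← hτ]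
      rw [← hτ, PosSemidef.eq_zero_of_re_trace hP hτ.symm,
        PosSemidef.eq_zero_of_re_trace hQ hQτ]
      simp
    · set τ := P.trace.re with hτdef
      have hτC : (τ : ℂ) ≠ 0 := Complex.ofReal_ne_zero.mpr hτ.ne'
      have hnorm : ∀ A : Op N, A.PosSemidef → A.trace = P.trace →
          IsDensity (((τ⁻¹ : ℝ) : ℂ) • A) := by
        intro A hA hAP
        refine ⟨hA.smul (Complex.zero_le_real.mpr (inv_pos.mpr hτ).le), ?_⟩
        rw [Matrix.trace_smul, hAP, ← him, Complex.ofReal_inv, smul_eq_mul, inv_mul_cancel₀ hτC]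
      have hle : ((amplitudeDamping γ N (((τ⁻¹ : ℝ) : ℂ) • P) -
          amplitudeDamping γ N (((τ⁻¹ : ℝ) : ℂ) • Q)) * S).trace.re ≤
          ((amplitudeDamping γ N P₀ - amplitudeDamping γ N Q₀) * S₀).trace.re :=
        hmax (a := (((τ⁻¹ : ℝ) : ℂ) • P, ((τ⁻¹ : ℝ) : ℂ) • Q, S))
          ⟨hnorm P hP rfl, hnorm Q hQ htrace.symm, hS⟩
      rw [map_smul, map_smul, ← smul_sub, Matrix.smul_mul, Matrix.trace_smul, smul_eq_mul,
        Complex.re_ofReal_mul, inv_mul_le_iff₀ hτ] at hle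
      linarith

lemma dampingNoise_subset (h0 : 0 < γ) (h1 : γ < 1) (N : ℕ) :
    dampingNoise γ N ⊆ nonunitalContractiveNoise N := by
  rintro _ ⟨hN, rfl⟩
  exact ⟨amplitudeDamping_isQuantumChannel h0 h1, amplitudeDamping_isStrictlyContractive h0 h1,
    amplitudeDamping_not_isUnital h0 hN⟩

/-! ### Fixed points of one-qubit amplitude damping -/

lemma zMean_amplitudeDamping (h0 : 0 < γ) (h1 : γ < 1) (A : Op 1) :
    zMean (amplitudeDamping γ 1 A) =
      (A (fun _ => 0) (fun _ => 0)).re - (1 - 2 * γ) * (A (fun _ => 1) (fun _ => 1)).re := by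
  have hs := Real.mul_self_sqrt h0.le
  have hs' := Real.mul_self_sqrt (sub_pos.mpr h1).le
  rw [zMean_eq, amplitudeDamping_eq, krausMap_apply]
  simp [Matrix.sum_apply, Matrix.mul_apply, sum_qubit, dampingKraus_apply, adKraus]
  linear_combination (A (fun _ => 1) (fun _ => 1)).re * (hs - hs')

lemma isDensity_diagState {z : ℝ} (h : -1 ≤ z) (h' : z ≤ 1) : IsDensity (diagState z) := by
  have e : diagState z = Matrix.diagonal fun i : Fin 1 → Fin 2 =>
      if i 0 = 0 then (((1 + z) / 2 : ℝ) : ℂ) else ((1 - z) / 2 : ℝ) := by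
    ext i j
    rw [diagState_apply, Matrix.diagonal_apply]
    split_ifs <;> simp
  constructor
  · rw [e]
    refine Matrix.PosSemidef.diagonal fun i => ?_
    dsimp only [Pi.zero_apply]
    split_ifs
    · exact Complex.zero_le_real.mpr (by linarith)
    · exact Complex.zero_le_real.mpr (by linarith)
  · rw [e, Matrix.trace_diagonal, sum_qubit]
    simp
    ring

/-- With `RY` of angle `x` the step is `z ↦ γ + (1 - γ) cos x * z`. Its fixed point determines `cos
x`, hence `x`, as cosine is injective on `[0, π]`. -/
lemma amplitudeDamping_hasInputDependentFixedPoint (h0 : 0 < γ) (h1 : γ < 1) :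
    HasInputDependentFixedPoint (amplitudeDamping γ 1) := by
  have hE := amplitudeDamping_isQuantumChannel (N := 1) h0 h1
  have hone : response (amplitudeDamping γ 1) 1 = γ := by
    rw [response, zMean_amplitudeDamping h0 h1]
    simp
  have hZ : response (amplitudeDamping γ 1) (onQubit 0 sigmaZ) = 1 - γ := by
    rw [response, zMean_amplitudeDamping h0 h1]
    simp [onQubit_apply, sigmaZ]
    ring
  have hX : response (amplitudeDamping γ 1) (onQubit 0 sigmaX) = 0 := by
    rw [response, zMean_amplitudeDamping h0 h1]
    simp [onQubit_apply, sigmaX]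
  have hmap : ∀ x z : ℝ, zMean (amplitudeDamping γ 1 (circuitUnitary x [Gate.ry 0 1 0] *
      diagState z * (circuitUnitary x [Gate.ry 0 1 0]).conjTranspose)) =
      γ + z * ((1 - γ) * Real.cos x) := by
    intro x z
    rw [zMean_noise_conj_diagState]
    simp only [circuitUnitary, Gate.matrix, Matrix.one_mul, pauliZ_eq, onQubit_conjTranspose,
      onQubit_mul, rotY_conj, onQubit_add, onQubit_smul, response_add]
    rw [response_smul, response_smul, hone, hZ, hX, one_mul, add_zero]
    ring
  have hden : ∀ x : ℝ, γ ≤ 1 - (1 - γ) * Real.cos x := by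
    intro x
    nlinarith [Real.cos_le_one x]
  have hpos : ∀ x : ℝ, 0 < 1 - (1 - γ) * Real.cos x := fun x => h0.trans_le (hden x)
  refine ⟨[Gate.ry 0 1 0], fun x => diagState (γ / (1 - (1 - γ) * Real.cos x)), ?_, fun x => ?_⟩
  · intro x y hxy
    have h2 := congrArg zMean hxy
    simp only [zMean_diagState] at h2
    rw [div_eq_div_iff (hpos x).ne' (hpos y).ne'] at h2
    have h3 := mul_left_cancel₀ h0.ne' h2
    have h4 : Real.cos x = Real.cos y :=
      mul_left_cancel₀ (sub_pos.mpr h1).ne' (by linarith)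
    have hmem : ∀ x : Set.Icc (0 : ℝ) 1, (x : ℝ) ∈ Set.Icc 0 Real.pi := fun x =>
      ⟨x.2.1, x.2.2.trans (by linarith [Real.pi_gt_three])⟩
    exact Subtype.ext (Real.injOn_cos (hmem x) (hmem y) h4)
  · have hd : IsDensity (diagState (γ / (1 - (1 - γ) * Real.cos x))) := by
      refine isDensity_diagState ?_ ((div_le_one (hpos x)).mpr (hden x))
      linarith [div_nonneg h0.le (hpos x).le]
    refine ⟨hd, fun σ hσ => ⟨fun h => ?_, ?_⟩⟩
    · obtain ⟨z, rfl⟩ : ∃ z, σ = diagState z :=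
        ⟨_, h.symm.trans (step_eq_diagState hE _ _ hσ)⟩
      rw [step_eq_diagState hE _ _ hσ, hmap] at h
      have h2 := congrArg zMean h
      rw [zMean_diagState, zMean_diagState] at h2
      congr 1
      rw [eq_div_iff (hpos x).ne']
      linarith
    · rintro rfl
      rw [step_eq_diagState hE _ _ hd, hmap]
      congr 1
      have := (hpos x).ne'
      field_simp
      ring

end Damping

end

end QESN

theorem mainTheorem1 (ω : ℤ → ℝ) (hω : QESN.IsFadingWeight ω) :
    -- every network with strictly contractive noise defines a fading-memory filter
    (∀ A : QESN.Multiplexed, A.UsesNoise QESN.contractiveNoise →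
      A.EchoState ∧ QESN.IsFadingMemoryFilter ω A.filter) ∧
    -- universality for every class of non-unital strictly contractive noises that contains a
    -- one-qubit noise with input-dependent fixed points
    (∀ 𝒩 : (N : ℕ) → Set (QESN.Op N →ₗ[ℂ] QESN.Op N),
      (∀ N, 𝒩 N ⊆ QESN.nonunitalContractiveNoise N) →
      (∃ E ∈ 𝒩 1, QESN.HasInputDependentFixedPoint E) →
      QESN.IsUniversal ω 𝒩) ∧
    -- amplitude damping is such a class
    (∀ γ : ℝ, 0 < γ → γ < 1 →
      (∀ N, QESN.dampingNoise γ N ⊆ QESN.nonunitalContractiveNoise N) ∧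
      (∃ E ∈ QESN.dampingNoise γ 1, QESN.HasInputDependentFixedPoint E) ∧
      QESN.IsUniversal ω (QESN.dampingNoise γ)) ∧
    -- the family of all networks with non-unital strictly contractive noise is universal
    QESN.IsUniversal ω QESN.nonunitalContractiveNoise := by
  have huniv : ∀ 𝒩 : (N : ℕ) → Set (QESN.Op N →ₗ[ℂ] QESN.Op N),
      (∀ N, 𝒩 N ⊆ QESN.nonunitalContractiveNoise N) →
      (∃ E ∈ 𝒩 1, QESN.HasInputDependentFixedPoint E) → QESN.IsUniversal ω 𝒩 := by
    rintro 𝒩 h𝒩 ⟨E, hE𝒩, hE⟩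
    exact QESN.isUniversal_of_inputDependentFixedPoint hω
      (fun N E hE => ⟨(h𝒩 N hE).1, (h𝒩 N hE).2.1⟩) hE𝒩 hE
  have hfix : ∀ γ : ℝ, 0 < γ → γ < 1 →
      ∃ E ∈ QESN.dampingNoise γ 1, QESN.HasInputDependentFixedPoint E := fun γ h0 h1 =>
    ⟨_, ⟨one_pos, rfl⟩, QESN.amplitudeDamping_hasInputDependentFixedPoint h0 h1⟩
  refine ⟨fun A hA => ⟨hA.echoState, hA.isFadingMemoryFilter hω⟩, huniv, fun γ h0 h1 =>
    ⟨QESN.dampingNoise_subset h0 h1, hfix γ h0 h1,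
      huniv _ (QESN.dampingNoise_subset h0 h1) (hfix γ h0 h1)⟩, ?_⟩
  -- Any strength in `(0, 1)` would serve as the witness.
  obtain ⟨E, hE, hE'⟩ := hfix (1 / 2) (by norm_num) (by norm_num)
  exact huniv _ (fun _ => subset_rfl)
    ⟨E, QESN.dampingNoise_subset (by norm_num) (by norm_num) 1 hE, hE'⟩
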